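/- **Setting.** Let $C$ be the space of continuous paths $\omega:[0,\infty)\to\mathbb R$ with $\omega(0)=0$, with the topology of uniform convergence on compacts and its Borel $\sigma$-algebra $\mathscr C$; let $\mathbb P$ be any probability measure on $(C,\mathscr C)$, $Z$ the canonical process $Z_x(\omega)=\omega(x)$, and $\mathrm e(x)=x$. For a path $\psi$ put $S(\psi)(x)=\sup\{\psi(u):0\le u<x\}$ for $x\in(0,\infty]$ and $S(\psi)(0)=\psi(0)$; for a path $\psi$ on $[0,T)$, $0<T\le\infty$, put $E(\psi)(x)=\inf\{u\in(0,T):\psi(u)>x\}$ with $\inf\varnothing=\infty$. For $\varepsilon>0$, a path $X$ on $[0,T)$, with $\bar X_t=\int_0^tX_u\,du$ well defined and $\ge 0$, solves the CIR time-change equation (TCE) along $\omega$ if $$\varepsilon(X_t-1)=\omega(\bar X_t)+t-\bar X_t\qquad(0\le t<T),$$ and $\varphi:[0,T)\to[0,\infty)$ solves the CIR initial-value problem (IVP) if $\varphi(0)=0$ and $\varphi'(t)=\varepsilon^{-1}(\omega(\varphi(t))+t-\varphi(t))+1$ on $[0,T)$. **Statement.** For every $\varepsilon>0$ there are a measurable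 life time $T_\varepsilon:C\to(0,\infty]$ and a process $X_\varepsilon$ on $[0,T_\varepsilon)$ (each $X_{\varepsilon,t}$ is measurable on $\{t<T_\varepsilon\}$) which solves the TCE along every $\omega\in C$. If $X'$ on $[0,T')$ solves the TCE $\mathbb P$-almost surely, then $\mathbb P$-almost surely $T'\le T_\varepsilon$ and $X'=X_\varepsilon$ on $[0,T')$. Moreover, for every $\omega\in C$ the following hold. 1. For every $\varepsilon>0$, the path $\varphi=\bar X_\varepsilon(\omega)$ solves the IVP and is a bijection from $[0,T_\varepsilon)$ onto $[0,\infty)$; $\varphi'=X_\varepsilon(\omega)\ge0$ vanishes on no nonempty open interval; $T_\varepsilon+\varepsilon\ge S(\mathrm e-\omega)(\infty)$, and $T_\varepsilon+\varepsilon>u-\omega(u)$ for all $u\ge0$ (so the first inequality is strict if the supremum is attained). 2. Every solution of the TCE, or of the IVP, along $\omega$ on some $[0,T')$ satisfies $T'\le T_\varepsilon$ and is the restriction of $X_\varepsilon(\omega)$, respectively $\bar X_\varepsilon(\omega)$. 3. The exit time $\hat X_\varepsilon=E(\bar X_\varepsilon(\omega))$ belongs to $C$ and is the inverse of $\bar X_\varepsilon(\omega)$.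 At $x$ it has derivative $1/X_\varepsilon(\hat X_\varepsilon(x))$ if $X_\varepsilon(\hat X_\varepsilon(x))\ne0$, and it is not differentiable otherwise. For all $x\ge0$, $$S(\mathrm e-\omega)(x)-\varepsilon\le\hat X_\varepsilon(x)\le S(\mathrm e-\omega)(x)+2\sqrt{x\varepsilon}.$$ 4. $\hat X_\varepsilon\to S(\mathrm e-\omega)$ in $C$ as $\varepsilon\to0$. 5. Let $\zeta=S(\mathrm e-\omega)(\infty)$. For $t\ge0$, $E(\mathrm e-\omega)(t)$ is finite if and only if $t<\zeta$; $E(\mathrm e-\omega)$ is càdlàg on $[0,\zeta)$, and each $\bar X_\varepsilon(\omega)$ is càdlàg on $[0,T_\varepsilon)$. As $\varepsilon\to0$, $\bar X_\varepsilon(\omega)\to E(\mathrm e-\omega)$ in Skorokhod's $M_1$ topology, with the convention $x(0-)=0$ at the origin ($M_1'$): for every continuity point $t\in(0,\zeta)$ of the limit, $T_\varepsilon>t$ for all small $\varepsilon$ and the $M_1$ distance of the restrictions to $[0,t]$ tends to $0$. (If $\zeta=\infty$ this is $M_1'$ convergence on $[0,\infty)$.) Moreover, with $\bar X_{\varepsilon,t}:=\infty$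 for $t\ge T_\varepsilon$, $\bar X_{\varepsilon,t}\to E(\mathrm e-\omega)(t)$ in $[0,\infty]$ at every $t>0$ where the $[0,\infty]$-valued function $E(\mathrm e-\omega)$ is continuous, in particular for all $t>\zeta$. Finally, let $\varepsilon>0$, let $\varphi:[0,T)\to[0,\infty)$ be any differentiable bijection and $\hat\varphi=E(\varphi)$; then $\hat\varphi'(x)=1/\varphi'(\hat\varphi(x))$ wherever $\varphi'(\hat\varphi(x))\neq0$. For $\omega\in C$, $\varphi$ solves the IVP along $\omega$ if and only if $\omega(x)=x-\hat\varphi(x)+\varepsilon(\hat\varphi'(x)^{-1}-1)$ for all $x\ge0$, where $\hat\varphi'(x)^{-1}$ means $\varphi'(\hat\varphi(x))$. Such an $\omega\in C$ exists if and only if $\varphi'$ is continuous and $\varphi'(0)=1$. -/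

import Mathlib

open Set Filter Topology MeasureTheory
open scoped ENNReal NNReal

noncomputable section

namespace CIR

/-! ### The path space and the canonical process -/

/-- The space `C` of continuous real paths on `[0, ∞)` which start from zero. -/
def PathSpace : Type := {ω : C(ℝ≥0, ℝ) // ω 0 = 0}

/-- The topology of `C`: uniform convergence on compact sets (the compact-open topology). -/
instance : TopologicalSpace PathSpace :=
  inferInstanceAs (TopologicalSpace {ω : C(ℝ≥0, ℝ) // ω 0 = 0})

/-- The sigma-algebra of `C`: the Borel sets of its topology. -/
instance : MeasurableSpace PathSpace := borel PathSpace

instance : BorelSpace PathSpace := ⟨rfl⟩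

/-- The canonical process `Z_x(ω) = ω(x)`; only levels `x ≥ 0` are ever relevant. -/
def Z (ω : PathSpace) (x : ℝ) : ℝ := ω.1 x.toNNReal

/-- The path `e - Z(ω)`, where `e` is the identity. -/
def eSubZ (ω : PathSpace) (x : ℝ) : ℝ := x - Z ω x

/-! ### Life times, exit times and running suprema -/

/-- The time interval `[0, T)` with `T ∈ [-∞, ∞]`. -/
def dom (T : EReal) : Set ℝ := {t | 0 ≤ t ∧ (t : EReal) < T}

/-- The exit time `E(ψ)(x) = inf {u > 0 : ψ(u) > x}` of a path `ψ` defined on `[0, T)`,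
with `inf ∅ = ∞`. -/
def E (T : EReal) (ψ : ℝ → ℝ) (x : ℝ) : EReal :=
  sInf ((fun u : ℝ => (u : EReal)) '' {u | u ∈ dom T ∧ 0 < u ∧ x < ψ u})

/-- The supremum `S(ψ)(x) = sup {ψ(u) : u ∈ [0, x)}` for `x ∈ (0, ∞]`, with `S(ψ)(0) = ψ(0)`
(the value `ψ(0)` belongs to the set for every `x > 0`, so the maximum only matters at `x = 0`). -/
def S (ψ : ℝ → ℝ) (x : EReal) : EReal :=
  max (ψ 0 : EReal) (⨆ u ∈ dom x, (ψ u : EReal))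

/-! ### The time-change equation and the initial-value problem -/

/-- The time-average (time-integral) of a path. -/
def timeAvg (X : ℝ → ℝ) (t : ℝ) : ℝ := ∫ u in (0 : ℝ)..t, X u

/-- `X`, defined on `[0, T)`, solves the time-change equation
`ε (X_t - 1) = Z(X̄_t) + t - X̄_t` along the path `ω`. Since `Z(ω)` is defined on `[0, ∞)` only,
`X̄` is nonnegative. -/
structure IsTCEPath (ε : ℝ) (ω : PathSpace) (T : EReal) (X : ℝ → ℝ) : Prop where
  pos : 0 < T
  integrable : ∀ t ∈ dom T, IntervalIntegrable X volume 0 t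
  nonneg : ∀ t ∈ dom T, 0 ≤ timeAvg X t
  eqn : ∀ t ∈ dom T, ε * (X t - 1) = Z ω (timeAvg X t) + t - timeAvg X t

/-- A process `X` on `C`, with random life time `T`, which solves the time-change equation along
every path. -/
structure IsTCEProcess (ε : ℝ) (T : PathSpace → EReal) (X : PathSpace → ℝ → ℝ) : Prop where
  measurable_life : Measurable T
  measurable : ∀ t : ℝ, 0 ≤ t →
    Measurable ({ω | (t : EReal) < T ω}.indicator (fun ω => X ω t))
  path : ∀ ω, IsTCEPath ε ω (T ω) (X ω)

/-- `f(t, x) = ε⁻¹ (ω(x) + t - x) + 1`. -/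
def drive (ε : ℝ) (ω : PathSpace) (t x : ℝ) : ℝ := ε⁻¹ * (Z ω x + t - x) + 1

/-- `φ : [0, T) → [0, ∞)` solves the initial-value problem `φ'(t) = f(t, φ(t))`, `φ(0) = 0`. -/
structure IsIVPSolution (ε : ℝ) (ω : PathSpace) (T : EReal) (φ : ℝ → ℝ) : Prop where
  pos : 0 < T
  zero : φ 0 = 0
  nonneg : ∀ t ∈ dom T, 0 ≤ φ t
  deriv : ∀ t ∈ dom T, HasDerivWithinAt φ (drive ε ω t (φ t)) (dom T) t

/-! ### Càdlàg paths and Skorokhod's `M₁` convergence -/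

/-- `x` is right-continuous with left limits on `[0, T)`. -/
def IsCadlagOn (T : EReal) (x : ℝ → ℝ) : Prop :=
  ∀ t ∈ dom T, ContinuousWithinAt x (Ici t) t ∧ (0 < t → ∃ l : ℝ, Tendsto x (𝓝[<] t) (𝓝 l))

/-- The left limit `x(s-)`, with the convention `x(0-) = 0` of the `M₁'` topology. -/
def leftValue (x : ℝ → ℝ) (s : ℝ) : ℝ := if s ≤ 0 then 0 else Function.leftLim x s

/-- The completed graph of `x` on `[0, t]`: all `(z, s)` with `s ∈ [0, t]` and `z` in the segment
between `x(s-)` and `x(s)`. -/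
def completedGraph (x : ℝ → ℝ) (t : ℝ) : Set (ℝ × ℝ) :=
  {p | p.2 ∈ Icc 0 t ∧ p.1 ∈ uIcc (leftValue x p.2) (x p.2)}

/-- The order on the completed graph: first by time, then by the distance to the left limit. -/
def graphLE (x : ℝ → ℝ) (p q : ℝ × ℝ) : Prop :=
  p.2 < q.2 ∨ (p.2 = q.2 ∧ |leftValue x p.2 - p.1| ≤ |leftValue x q.2 - q.1|)

/-- The parametric representations of `x` on `[0, t]`: continuous nondecreasing maps from `[0, 1]`
onto the completed graph. -/
def paramReps (x : ℝ → ℝ) (t : ℝ) : Set C(unitInterval, ℝ × ℝ) :=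
  {p | range p = completedGraph x t ∧ ∀ a b, a ≤ b → graphLE x (p a) (p b)}

/-- The `M₁` distance on `[0, t]`: the infimum, over parametric representations of `x` and `y`,
of their uniform distance (with the maximum norm on `ℝ × ℝ`). -/
def m1Dist (t : ℝ) (x y : ℝ → ℝ) : ℝ≥0∞ :=
  ⨅ p ∈ paramReps x t, ⨅ q ∈ paramReps y t, edist p q

/-- `M₁` convergence of the càdlàg paths `x i` on `[0, T i)` to the càdlàg path `y` on `[0, ζ)`:
at every continuity point `0 < t < ζ` of `y`, the `x i` are eventually defined on `[0, t]`, and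
their `M₁` distance on `[0, t]` to `y` tends to zero. For `ζ = ∞` and `T i = ∞` this is the usual
notion on `D([0, ∞), ℝ)`. -/
def TendstoM1 {ι : Type*} (l : Filter ι) (T : ι → EReal) (x : ι → ℝ → ℝ) (ζ : EReal)
    (y : ℝ → ℝ) : Prop :=
  ∀ t : ℝ, 0 < t → (t : EReal) < ζ → ContinuousAt y t →
    (∀ᶠ i in l, (t : EReal) < T i) ∧ Tendsto (fun i => m1Dist t (x i) y) l (𝓝 0)

/-- The value at time `t` of a path on `[0, T)`, set to `∞` from the life time on. -/
def extValue (T : EReal) (x : ℝ → ℝ) (t : ℝ) : EReal :=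
  open Classical in if (t : EReal) < T then (x t : EReal) else ⊤

end CIR

end

open CIR

namespace CIR

/-! ### Comparison and existence for scalar differential equations -/

/-! The drive `f(t, x)` is merely continuous in `x`, but it is strictly increasing in `t`, and this
replaces any Lipschitz condition. A solution advanced by a time `η > 0` has a strictly larger
right-hand side at equal heights, so another solution cannot cross above it (`le_comp_add_of_lt`);
letting `η → 0` gives uniqueness. Comparing a solution with its own shift shows that it is
nondecreasing, and strictly so, since on a flat stretch the drive would vanish at several times at
one level. The same comparison gives existence, because Lipschitz approximations have solutions that
are Cauchy up to small time shifts, and continuity of the exit times in `ω`, hence measurability.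
The growth of `f` in `t` carries solutions to every level, so the maximal solution is an increasing
bijection onto `[0, ∞)`. The time-change equation is the same problem written for `X = φ'`.

The asymptotics are read off the inverse. That `φ' ≥ 0` when level `u` is reached says `u - ω(u) - ε
≤ X̂(u)`. Conversely, after time `a = S(e - ω)(x)` one has `φ' ≥ (t - a)/ε` until level `x` is
reached, which therefore takes at most `2√(xε)` longer. So the inverses converge locally uniformly
to `S(e - ω)`. The completed graph of a right-continuous inverse on `[0, t]` is the transposed graph
of the original path, so uniform convergence of the inverses becomes `M₁` convergence once the end
values at `t` converge, which they do at continuity points. -/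

theorem le_comp_add_of_lt {F₁ F₂ : ℝ → ℝ → ℝ} {φ₁ φ₂ : ℝ → ℝ} {b η : ℝ} (hη : 0 ≤ η)
    (h₁ : ∀ t ∈ Icc 0 b, HasDerivWithinAt φ₁ (F₁ t (φ₁ t)) (Icc 0 b) t)
    (h₂ : ∀ t ∈ Icc 0 (b + η), HasDerivWithinAt φ₂ (F₂ t (φ₂ t)) (Icc 0 (b + η)) t)
    (h0 : φ₁ 0 ≤ φ₂ η)
    (hF : ∀ t ∈ Icc 0 b, φ₁ t = φ₂ (t + η) → F₁ t (φ₁ t) < F₂ (t + η) (φ₁ t)) :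
    ∀ t ∈ Icc 0 b, φ₁ t ≤ φ₂ (t + η) := by
  have hs : ∀ t ∈ Icc 0 b,
      HasDerivWithinAt (fun s => φ₂ (s + η)) (F₂ (t + η) (φ₂ (t + η))) (Icc 0 b) t := by
    intro t ht
    have h := h₂ (t + η) ⟨by linarith [ht.1], by linarith [ht.2]⟩
    have hm : MapsTo (fun s : ℝ => s + η) (Icc 0 b) (Icc 0 (b + η)) :=
      fun s hs => ⟨by linarith [hs.1], by linarith [hs.2]⟩
    simpa [Function.comp_def] using
      HasDerivWithinAt.comp t h ((hasDerivWithinAt_id t (Icc 0 b)).add_const η) hm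
  have hIci : ∀ {f : ℝ → ℝ} {f' t : ℝ}, t ∈ Ico 0 b → HasDerivWithinAt f f' (Icc 0 b) t →
      HasDerivWithinAt f f' (Ici t) t := fun ht h =>
    (h.mono (Icc_subset_Icc_left ht.1)).mono_of_mem_nhdsWithin (Icc_mem_nhdsGE ht.2)
  refine image_le_of_deriv_right_lt_deriv_boundary' (f' := fun t => F₁ t (φ₁ t))
    (B' := fun t => F₂ (t + η) (φ₂ (t + η))) (fun t ht => (h₁ t ht).continuousWithinAt)
    (fun t ht => hIci ht (h₁ t (Ico_subset_Icc_self ht))) (by simpa using h0)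
    (fun t ht => (hs t ht).continuousWithinAt)
    (fun t ht => hIci ht (hs t (Ico_subset_Icc_self ht))) ?_
  intro t ht he
  rw [← he]
  exact hF t (Ico_subset_Icc_self ht) he

theorem nonneg_of_hasDerivWithinAt {F : ℝ → ℝ → ℝ} {φ : ℝ → ℝ} {b : ℝ}
    (h : ∀ t ∈ Icc 0 b, HasDerivWithinAt φ (F t (φ t)) (Icc 0 b) t) (h0 : 0 ≤ φ 0)
    (hF : ∀ t ∈ Icc 0 b, 0 < F t 0) : ∀ t ∈ Icc 0 b, 0 ≤ φ t := by
  intro t ht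
  have := le_comp_add_of_lt (F₁ := fun _ _ => 0) (F₂ := F) (φ₁ := fun _ => 0) (φ₂ := φ)
    (η := 0) le_rfl (fun t _ => hasDerivWithinAt_const ..) (by simpa using h) (by simpa using h0)
    (fun t ht _ => by simpa using hF t ht) t ht
  simpa using this

theorem exists_solution_of_lipschitz {G : ℝ → ℝ} {K : ℝ≥0} (hG : LipschitzWith K G) {M c N : ℝ}
    (hM : ∀ x, |G x| ≤ M) (hc : 0 ≤ c) (hN : 0 ≤ N) :
    ∃ φ : ℝ → ℝ, φ 0 = 0 ∧
      ∀ t ∈ Icc 0 N, HasDerivWithinAt φ (G (φ t) + c * t) (Icc 0 N) t := by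
  have hM0 : 0 ≤ M := (abs_nonneg _).trans (hM 0)
  have hL : 0 ≤ M + c * N := by positivity
  -- The speed is at most `M + c * N`, so a ball of radius `(M + c * N) * N` holds the solution for
  -- the whole time `N`, and no continuation argument is needed.
  refine IsPicardLindelof.exists_eq_forall_mem_Icc_hasDerivWithinAt₀
    (f := fun t x => G x + c * t) (t₀ := ⟨0, le_rfl, hN⟩)
    (a := NNReal.mk ((M + c * N) * N) (by positivity)) (L := NNReal.mk (M + c * N) hL) (K := K) ?_
  refine ⟨fun t _ => ?_, fun x _ => by fun_prop, fun t ht x _ => ?_, ?_⟩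
  · exact (LipschitzWith.of_dist_le_mul fun x y => by
      simpa [Real.dist_eq] using hG.dist_le_mul x y).lipschitzOnWith
  · rw [Real.norm_eq_abs, NNReal.coe_mk]
    refine (abs_add_le _ _).trans (add_le_add (hM x) ?_)
    rw [abs_of_nonneg (mul_nonneg hc ht.1)]
    exact mul_le_mul_of_nonneg_left ht.2 hc
  · simp [hN]

/-- A Weierstrass polynomial is Lipschitz on `[0, R]`; composing it with the 1-Lipschitz clamp makes
it Lipschitz on the whole line. -/
theorem exists_lipschitz_near {g : ℝ → ℝ} (hg : Continuous g) {R δ : ℝ} (hR : 0 ≤ R)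
    (hδ : 0 < δ) :
    ∃ (G : ℝ → ℝ) (K : ℝ≥0), LipschitzWith K G ∧
      ∀ x, |G x - g (max 0 (min R x))| < δ := by
  obtain ⟨p, hp⟩ := exists_polynomial_near_of_continuousOn 0 R g hg.continuousOn δ hδ
  have hp1 : ContDiff ℝ 1 fun x => p.eval x := by
    simpa using Polynomial.contDiff_aeval p 1 (𝕜 := ℝ)
  obtain ⟨K, hK⟩ := hp1.locallyLipschitz.locallyLipschitzOn (s := Icc 0 R)
    |>.exists_lipschitzOnWith_of_compact isCompact_Icc
  have hmem : ∀ x : ℝ, max 0 (min R x) ∈ Icc 0 R := fun x =>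
    ⟨le_max_left _ _, max_le hR (min_le_left _ _)⟩
  refine ⟨fun x => p.eval (max 0 (min R x)), K, ?_, fun x => hp _ (hmem x)⟩
  have h1 : LipschitzWith 1 fun x : ℝ => max 0 (min R x) :=
    (LipschitzWith.id.const_min R).const_max 0
  intro x y
  refine (hK (hmem x) (hmem y)).trans ?_
  gcongr
  simpa using h1 x y

theorem lipschitz_of_hasDerivWithinAt {φ φ' : ℝ → ℝ} {b L : ℝ}
    (h : ∀ t ∈ Icc 0 b, HasDerivWithinAt φ (φ' t) (Icc 0 b) t)
    (hL : ∀ t ∈ Icc 0 b, |φ' t| ≤ L) {s t : ℝ} (hs : s ∈ Icc 0 b) (ht : t ∈ Icc 0 b) :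
    |φ t - φ s| ≤ L * |t - s| := by
  simpa [Real.norm_eq_abs] using
    (convex_Icc 0 b).norm_image_sub_le_of_norm_hasDerivWithin_le h (by simpa using hL) hs ht

theorem integral_eq_of_hasDerivWithinAt {φ φ' : ℝ → ℝ} {b : ℝ}
    (h : ∀ t ∈ Icc 0 b, HasDerivWithinAt φ (φ' t) (Icc 0 b) t) (hc : ContinuousOn φ' (Icc 0 b))
    {t : ℝ} (ht : t ∈ Icc 0 b) : ∫ s in (0 : ℝ)..t, φ' s = φ t - φ 0 := by
  have hsub : Icc 0 t ⊆ Icc 0 b := Icc_subset_Icc_right ht.2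
  refine intervalIntegral.integral_eq_sub_of_hasDeriv_right_of_le ht.1
    (fun s hs => (h s (hsub hs)).continuousWithinAt.mono hsub) (fun s hs => ?_) ?_
  · have hs' : s ∈ Ico 0 b := ⟨hs.1.le, hs.2.trans_le ht.2⟩
    exact (((h s (Ico_subset_Icc_self hs')).mono
      (Icc_subset_Icc_left hs'.1)).mono_of_mem_nhdsWithin (Icc_mem_nhdsGE hs'.2)).mono
      Ioi_subset_Ici_self
  · exact (hc.mono (by rwa [uIcc_of_le ht.1])).intervalIntegrable

/-- No compactness extraction is needed: the term `c * t` lets a small time shift absorb the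
approximation errors, so the whole sequence of approximate solutions converges. -/
theorem exists_solution_of_continuous {g : ℝ → ℝ} (hg : Continuous g) {R c N : ℝ} (hR : 0 ≤ R)
    (hg0 : 0 < g 0) (hc : 0 < c) (hN : 0 ≤ N) :
    ∃ φ : ℝ → ℝ, φ 0 = 0 ∧ (∀ t ∈ Icc 0 N, 0 ≤ φ t) ∧
      ∀ t ∈ Icc 0 N, HasDerivWithinAt φ (g (max 0 (min R (φ t))) + c * t) (Icc 0 N) t := by
  set γ : ℝ → ℝ := fun x => g (max 0 (min R x)) with hγ
  have hγc : Continuous γ := by fun_prop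
  have hγ0 : γ 0 = g 0 := by simp [hγ, hR]
  obtain ⟨M, hM⟩ : ∃ M, ∀ x, |γ x| ≤ M := by
    obtain ⟨M, hM⟩ := (isCompact_Icc (a := 0) (b := R)).exists_bound_of_continuousOn hg.continuousOn
    exact ⟨M, fun x => hM _ ⟨le_max_left _ _, max_le hR (min_le_left _ _)⟩⟩
  -- Errors below `1` give the common bound `M + 1`; errors below `g 0` keep `G n 0` positive, so
  -- zero is a strict subsolution and the `f n` stay nonnegative.
  obtain ⟨u, -, hu, hulim⟩ := exists_seq_strictAnti_tendsto' (lt_min one_pos hg0)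
  have hu0 : ∀ n, 0 < u n := fun n => (hu n).1
  have hu1 : ∀ n, u n < 1 := fun n => (hu n).2.trans_le (min_le_left _ _)
  choose G K hGK hG using fun n => exists_lipschitz_near hg hR (hu0 n)
  change ∀ n x, |G n x - γ x| < u n at hG
  have hGM : ∀ n x, |G n x| ≤ M + 1 := fun n x => by
    have h1 := abs_lt.1 (hG n x)
    have h2 := abs_le.1 (hM x)
    exact abs_le.2 ⟨by linarith [hu1 n], by linarith [hu1 n]⟩
  have hG0 : ∀ n, 0 < G n 0 := fun n => by
    have h1 := abs_lt.1 (hG n 0)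
    have h2 := (hu n).2.trans_le (min_le_right _ _)
    rw [hγ0] at h1
    linarith
  -- The extra unit of time leaves room for shifts `η ≤ 1`.
  choose f hf0 hf using fun n => exists_solution_of_lipschitz (hGK n) (hGM n) hc.le
    (N := N + 1) (by linarith)
  have hfnn : ∀ n, ∀ t ∈ Icc 0 (N + 1), 0 ≤ f n t := fun n =>
    nonneg_of_hasDerivWithinAt (F := fun t x => G n x + c * t) (hf n) (hf0 n).ge
      fun t ht => add_pos_of_pos_of_nonneg (hG0 n) (mul_nonneg hc.le ht.1)
  set L : ℝ := M + 1 + c * (N + 1) with hL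
  have hbd : ∀ n, ∀ t ∈ Icc 0 (N + 1), ∀ x, |G n x + c * t| ≤ L := fun n t ht x => by
    refine (abs_add_le _ _).trans (add_le_add (hGM n x) ?_)
    rw [abs_of_nonneg (mul_nonneg hc.le ht.1)]
    exact mul_le_mul_of_nonneg_left ht.2 hc.le
  have hlip : ∀ n, ∀ s ∈ Icc 0 (N + 1), ∀ t ∈ Icc 0 (N + 1), |f n t - f n s| ≤ L * |t - s| :=
    fun n s hs t ht => lipschitz_of_hasDerivWithinAt (hf n) (fun t ht => hbd n t ht _) hs ht
  have hL0 : 0 ≤ L := (abs_nonneg _).trans (hbd 0 0 ⟨le_rfl, by linarith⟩ 0)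
  -- Two approximate solutions differ by at most a small time shift.
  have hcmp : ∀ n m, (u n + u m) / c ≤ 1 → ∀ t ∈ Icc 0 N,
      f n t ≤ f m t + L * ((u n + u m) / c) := by
    intro n m hη t ht
    have hη0 : 0 < (u n + u m) / c := div_pos (add_pos (hu0 n) (hu0 m)) hc
    set η := (u n + u m) / c with hηd
    -- The shift raises the drive by exactly the sum of the two approximation errors.
    have hcη : c * η = u n + u m := by rw [hηd]; field_simp
    have h1 : ∀ t ∈ Icc 0 N, HasDerivWithinAt (f n) (G n (f n t) + c * t) (Icc 0 N) t :=
      fun t ht => (hf n t ⟨ht.1, by linarith [ht.2]⟩).mono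
        (Icc_subset_Icc_right (by linarith))
    have h2 : ∀ t ∈ Icc 0 (N + η),
        HasDerivWithinAt (f m) (G m (f m t) + c * t) (Icc 0 (N + η)) t :=
      fun t ht => (hf m t ⟨ht.1, by linarith [ht.2]⟩).mono
        (Icc_subset_Icc_right (by linarith))
    have h3 := le_comp_add_of_lt (F₁ := fun t x => G n x + c * t)
      (F₂ := fun t x => G m x + c * t) hη0.le h1 h2
      (by rw [hf0]; exact hfnn m η ⟨hη0.le, by linarith⟩) (fun t ht _ => by
        have h4 := abs_lt.1 (hG n (f n t))
        have h5 := abs_lt.1 (hG m (f n t))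
        rw [mul_add, hcη]
        linarith) t ht
    have h6 := hlip m t ⟨ht.1, by linarith [ht.2]⟩ (t + η)
      ⟨by linarith [ht.1], by linarith [ht.2]⟩
    rw [add_sub_cancel_left, abs_of_pos hη0] at h6
    linarith [(abs_le.1 h6).2]
  have hcau : ∀ t ∈ Icc 0 N, CauchySeq fun n => f n t := by
    intro t ht
    have hlim : Tendsto (fun p : ℕ × ℕ => (u p.1 + u p.2) / c) atTop (𝓝 0) := by
      rw [← prod_atTop_atTop_eq]
      simpa using ((hulim.comp tendsto_fst).add (hulim.comp tendsto_snd)).div_const c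
    have hlim' : Tendsto (fun p : ℕ × ℕ => L * ((u p.1 + u p.2) / c)) atTop (𝓝 0) := by
      simpa using hlim.const_mul L
    rw [Metric.cauchySeq_iff']
    intro δ hδ
    rw [← prod_atTop_atTop_eq] at hlim hlim'
    have hev := (hlim.eventually (gt_mem_nhds one_pos)).and (hlim'.eventually (gt_mem_nhds hδ))
    rw [prod_atTop_atTop_eq] at hev
    obtain ⟨⟨a, b⟩, hab⟩ := eventually_atTop.1 hev
    refine ⟨max a b, fun n hn => ?_⟩
    have h1 := hab (n, max a b) ⟨(le_max_left _ _).trans hn, le_max_right _ _⟩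
    have h2 := hcmp n (max a b) h1.1.le t ht
    have h3 := hcmp (max a b) n (by rw [add_comm]; exact h1.1.le) t ht
    rw [add_comm (u (max a b))] at h3
    have h4 := h1.2
    rw [Real.dist_eq, abs_lt]
    constructor <;> linarith
  choose! φ hφ using fun t ht => cauchySeq_tendsto_of_complete (hcau t ht)
  have hsub : Icc 0 N ⊆ Icc 0 (N + 1) := Icc_subset_Icc_right (by linarith)
  have hφlip : ∀ s ∈ Icc 0 N, ∀ t ∈ Icc 0 N, |φ t - φ s| ≤ L * |t - s| := fun s hs t ht =>
    le_of_tendsto ((hφ t ht).sub (hφ s hs)).abs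
      (Eventually.of_forall fun n => hlip n s (hsub hs) t (hsub ht))
  have hφc : ContinuousOn φ (Icc 0 N) := by
    refine LipschitzOnWith.continuousOn (K := NNReal.mk L hL0) ?_
    exact LipschitzOnWith.of_dist_le_mul fun s hs t ht => by
      simpa [Real.dist_eq] using hφlip t ht s hs
  have hγφ : ContinuousOn (fun t => γ (φ t) + c * t) (Icc 0 N) :=
    (hγc.comp_continuousOn hφc).add (by fun_prop)
  have hφ0 : φ 0 = 0 := by
    refine tendsto_nhds_unique (hφ 0 ⟨le_rfl, hN⟩) ?_
    simp [hf0]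
  -- The limit is taken in the integral equation, where pointwise convergence and the bound `L`
  -- suffice.
  have hint : ∀ t ∈ Icc 0 N, φ t = ∫ s in (0 : ℝ)..t, (γ (φ s) + c * s) := by
    intro t ht
    have hst : ∀ s ∈ uIoc 0 t, s ∈ Icc 0 N := fun s hs => by
      rw [uIoc_of_le ht.1] at hs
      exact ⟨hs.1.le, hs.2.trans ht.2⟩
    have hcont : ∀ n, ContinuousOn (fun s => G n (f n s) + c * s) (Icc 0 (N + 1)) := fun n =>
      ((hGK n).continuous.comp_continuousOn fun s hs => (hf n s hs).continuousWithinAt).add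
        (by fun_prop)
    refine tendsto_nhds_unique (hφ t ht) ?_
    have heq : ∀ n, f n t = ∫ s in (0 : ℝ)..t, (G n (f n s) + c * s) := fun n => by
      rw [integral_eq_of_hasDerivWithinAt (hf n) (hcont n) (hsub ht), hf0, sub_zero]
    simp_rw [heq]
    refine intervalIntegral.tendsto_integral_filter_of_dominated_convergence (fun _ => L)
      (Eventually.of_forall fun n => ?_) (Eventually.of_forall fun n => ?_)
      intervalIntegrable_const ?_
    · refine (((hcont n).mono ?_).aestronglyMeasurable measurableSet_uIoc)
      exact fun s hs => hsub (hst s hs)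
    · exact Eventually.of_forall fun s hs => hbd n s (hsub (hst s hs)) _
    · refine Eventually.of_forall fun s hs => Tendsto.add_const _ ?_
      have h1 := (hγc.tendsto (φ s)).comp (hφ s (hst s hs))
      have h2 : Tendsto (fun n => G n (f n s) - γ (f n s)) atTop (𝓝 0) :=
        squeeze_zero_norm (fun n => (hG n (f n s)).le) hulim
      simpa using h2.add h1
  refine ⟨φ, hφ0, fun t ht => ge_of_tendsto' (hφ t ht) fun n => hfnn n t (hsub ht), ?_⟩
  intro t ht
  have hii : IntervalIntegrable (fun s => γ (φ s) + c * s) volume 0 t :=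
    (hγφ.mono (by rw [uIcc_of_le ht.1]; exact Icc_subset_Icc_right ht.2)).intervalIntegrable
  have : Fact (t ∈ Icc 0 N) := ⟨ht⟩
  refine HasDerivWithinAt.congr (intervalIntegral.integral_hasDerivWithinAt_right hii
    (hγφ.stronglyMeasurableAtFilter_nhdsWithin measurableSet_Icc t) (hγφ t ht)) hint (hint t ht)

/-! ### Time intervals and inverses of increasing bijections -/

theorem mem_dom_of_le {T : EReal} {s t : ℝ} (hs : 0 ≤ s) (hst : s ≤ t) (ht : t ∈ dom T) :
    s ∈ dom T := ⟨hs, (EReal.coe_le_coe_iff.2 hst).trans_lt ht.2⟩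

theorem dom_mono {T T' : EReal} (h : T ≤ T') : dom T ⊆ dom T' := fun _ ht => ⟨ht.1, ht.2.trans_le h⟩

theorem Icc_subset_dom {T : EReal} {b : ℝ} (hb : (b : EReal) < T) : Icc 0 b ⊆ dom T :=
  fun _ ht => ⟨ht.1, (EReal.coe_le_coe_iff.2 ht.2).trans_lt hb⟩

theorem exists_gt_mem_dom {T : EReal} {t : ℝ} (ht : t ∈ dom T) {b : ℝ} (hb : t < b) :
    ∃ u ∈ dom T, t < u ∧ u < b := by
  obtain ⟨u, hu, hu'⟩ := EReal.lt_iff_exists_real_btwn.1 (lt_min ht.2 (EReal.coe_lt_coe_iff.2 hb))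
  exact ⟨u, ⟨ht.1.trans (EReal.coe_lt_coe_iff.1 hu).le, hu'.trans_le (min_le_left _ _)⟩,
    EReal.coe_lt_coe_iff.1 hu, EReal.coe_lt_coe_iff.1 (hu'.trans_le (min_le_right _ _))⟩

theorem exists_gt_mem_dom' {T : EReal} {t : ℝ} (ht : t ∈ dom T) : ∃ u ∈ dom T, t < u :=
  let ⟨u, hu, hu', _⟩ := exists_gt_mem_dom ht (lt_add_one t)
  ⟨u, hu, hu'⟩

theorem zero_mem_dom {T : EReal} (hT : 0 < T) : (0 : ℝ) ∈ dom T := ⟨le_rfl, by simpa using hT⟩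

theorem uniqueDiffWithinAt_dom {T : EReal} {t : ℝ} (ht : t ∈ dom T) :
    UniqueDiffWithinAt ℝ (dom T) t := by
  obtain ⟨u, hu, htu⟩ := exists_gt_mem_dom' ht
  refine (uniqueDiffOn_Icc (ht.1.trans_lt htu) t ⟨ht.1, htu.le⟩).mono (Icc_subset_dom hu.2)

theorem dom_mem_nhdsGE {T : EReal} {t : ℝ} (ht : t ∈ dom T) : dom T ∈ 𝓝[≥] t := by
  obtain ⟨u, hu, htu⟩ := exists_gt_mem_dom' ht
  exact mem_of_superset (Icc_mem_nhdsGE htu) fun s hs => mem_dom_of_le (ht.1.trans hs.1) hs.2 hu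

theorem dom_mem_nhds {T : EReal} {t : ℝ} (ht : t ∈ dom T) (ht0 : 0 < t) : dom T ∈ 𝓝 t := by
  obtain ⟨u, hu, htu⟩ := exists_gt_mem_dom' ht
  exact mem_of_superset (Icc_mem_nhds ht0 htu) fun s hs => mem_dom_of_le hs.1 hs.2 hu

/-- An increasing bijection from a time interval `[0, T)` onto `[0, ∞)`. -/
structure IsTimeChange (T : EReal) (φ : ℝ → ℝ) : Prop where
  strictMonoOn : StrictMonoOn φ (dom T)
  bijOn : BijOn φ (dom T) (Ici 0)

/-- The real-valued exit time. -/
noncomputable def exit (T : EReal) (φ : ℝ → ℝ) (x : ℝ) : ℝ := (E T φ x).toReal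

namespace IsTimeChange

variable {T : EReal} {φ : ℝ → ℝ} (h : IsTimeChange T φ)
include h

/-- By strict monotonicity the infimum runs over the `u > t` in `dom T`, and these accumulate at `t`
because `dom T` has no last point. -/
theorem E_apply {t : ℝ} (ht : t ∈ dom T) : E T φ (φ t) = t := by
  apply le_antisymm
  · refine le_of_forall_gt fun c hc => ?_
    obtain ⟨u, hu, huc⟩ := EReal.lt_iff_exists_real_btwn.1 (lt_min hc ht.2)
    have htu : t < u := EReal.coe_lt_coe_iff.1 hu
    have hud : u ∈ dom T := ⟨ht.1.trans htu.le, huc.trans_le (min_le_right _ _)⟩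
    have hle : E T φ (φ t) ≤ u :=
      sInf_le ⟨u, ⟨hud, ht.1.trans_lt htu, h.strictMonoOn ht hud htu⟩, rfl⟩
    exact hle.trans_lt (huc.trans_le (min_le_left _ _))
  · refine le_sInf ?_
    rintro _ ⟨u, ⟨hu, -, hlt⟩, rfl⟩
    exact EReal.coe_le_coe_iff.2 ((h.strictMonoOn.lt_iff_lt ht hu).1 hlt).le

theorem exit_apply {t : ℝ} (ht : t ∈ dom T) : exit T φ (φ t) = t := by
  simp [exit, h.E_apply ht]

theorem exit_mem {x : ℝ} (hx : 0 ≤ x) : exit T φ x ∈ dom T := by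
  obtain ⟨t, ht, rfl⟩ := h.bijOn.surjOn hx
  rwa [h.exit_apply ht]

theorem apply_exit {x : ℝ} (hx : 0 ≤ x) : φ (exit T φ x) = x := by
  obtain ⟨t, ht, rfl⟩ := h.bijOn.surjOn hx
  rw [h.exit_apply ht]

theorem coe_exit {x : ℝ} (hx : 0 ≤ x) : (exit T φ x : EReal) = E T φ x := by
  obtain ⟨t, ht, rfl⟩ := h.bijOn.surjOn hx
  rw [h.exit_apply ht, h.E_apply ht]

theorem lt_exit_iff {t x : ℝ} (ht : t ∈ dom T) (hx : 0 ≤ x) : t < exit T φ x ↔ φ t < x := by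
  rw [← h.strictMonoOn.lt_iff_lt ht (h.exit_mem hx), h.apply_exit hx]

theorem exit_lt_iff {t x : ℝ} (ht : t ∈ dom T) (hx : 0 ≤ x) : exit T φ x < t ↔ x < φ t := by
  rw [← h.strictMonoOn.lt_iff_lt (h.exit_mem hx) ht, h.apply_exit hx]

theorem strictMonoOn_exit : StrictMonoOn (exit T φ) (Ici 0) := fun x hx z hz hxz => by
  rwa [h.lt_exit_iff (h.exit_mem hx) hz, h.apply_exit hx]

theorem pos : 0 < T := by
  obtain ⟨t, ht, -⟩ := h.bijOn.surjOn (mem_Ici.2 (le_refl (0 : ℝ)))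
  exact lt_of_le_of_lt (by exact_mod_cast ht.1) ht.2

theorem apply_zero : φ 0 = 0 := by
  have h0 := zero_mem_dom h.pos
  refine le_antisymm ?_ (h.bijOn.mapsTo h0)
  have h1 := h.exit_mem le_rfl
  calc φ 0 ≤ φ (exit T φ 0) := h.strictMonoOn.monotoneOn h0 h1 h1.1
    _ = 0 := h.apply_exit le_rfl

theorem exit_zero : exit T φ 0 = 0 := by
  simpa [h.apply_zero] using h.exit_apply (zero_mem_dom h.pos)

/-- Monotonicity and surjectivity suffice: the order equivalences turn bounds on `exit` into strict
bounds on the level, which are open conditions. -/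
theorem continuousOn_exit : ContinuousOn (exit T φ) (Ici 0) := by
  intro x hx
  have hx' : (0 : ℝ) ≤ x := hx
  have hmem := h.exit_mem hx'
  refine tendsto_order.2 ⟨fun a ha => ?_, fun b hb => ?_⟩
  · rcases lt_or_ge a 0 with ha0 | ha0
    · filter_upwards [self_mem_nhdsWithin] with z hz
      exact ha0.trans_le (h.exit_mem hz).1
    · have had := mem_dom_of_le ha0 ha.le hmem
      have h1 := (h.lt_exit_iff had hx').1 ha
      filter_upwards [self_mem_nhdsWithin, mem_nhdsWithin_of_mem_nhds (lt_mem_nhds h1)]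
        with z hz hz'
      exact (h.lt_exit_iff had hz).2 hz'
  · obtain ⟨u, hu, h1, h2⟩ := exists_gt_mem_dom hmem hb
    have h3 := (h.exit_lt_iff hu hx').1 h1
    filter_upwards [self_mem_nhdsWithin, mem_nhdsWithin_of_mem_nhds (gt_mem_nhds h3)]
      with z hz hz'
    exact ((h.exit_lt_iff hu hz).2 hz').trans h2

theorem hasDerivWithinAt_exit {x d : ℝ} (hx : 0 ≤ x)
    (hd : HasDerivWithinAt φ d (dom T) (exit T φ x)) (hd0 : d ≠ 0) :
    HasDerivWithinAt (exit T φ) d⁻¹ (Ici 0) x := by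
  have hf : HasFDerivWithinAt φ
      (ContinuousLinearEquiv.unitsEquivAut ℝ (Units.mk0 d hd0) : ℝ →L[ℝ] ℝ) (dom T)
      (exit T φ x) := by
    have he : (ContinuousLinearEquiv.unitsEquivAut ℝ (Units.mk0 d hd0) : ℝ →L[ℝ] ℝ) =
        ContinuousLinearMap.toSpanSingleton ℝ d := by ext; simp
    rw [he]
    exact hd.hasFDerivWithinAt
  have hg : Tendsto (exit T φ) (𝓝[Ici 0] x) (𝓝[dom T] (exit T φ x)) :=
    tendsto_nhdsWithin_iff.2 ⟨h.continuousOn_exit x hx, by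
      filter_upwards [self_mem_nhdsWithin] with z hz using h.exit_mem hz⟩
  have := hf.of_local_left_inverse hg hx (by
    filter_upwards [self_mem_nhdsWithin] with z hz using h.apply_exit hz)
  simpa using this.hasDerivWithinAt

/-- Otherwise the chain rule would give the identity `φ ∘ exit` the derivative `0`. -/
theorem not_differentiableWithinAt_exit {x : ℝ} (hx : 0 ≤ x)
    (hd : HasDerivWithinAt φ 0 (dom T) (exit T φ x)) :
    ¬ DifferentiableWithinAt ℝ (exit T φ) (Ici 0) x := by
  intro hdiff
  have h1 := hd.comp x hdiff.hasDerivWithinAt fun z hz => h.exit_mem hz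
  have h2 : HasDerivWithinAt (φ ∘ exit T φ) 1 (Ici 0) x :=
    (hasDerivWithinAt_id x (Ici 0)).congr (fun z hz => h.apply_exit hz) (h.apply_exit hx)
  have := (uniqueDiffOn_Ici (0 : ℝ) x hx).eq_deriv _ h1 h2
  simp at this

end IsTimeChange

theorem isTimeChange_of_continuousOn {T : EReal} {φ : ℝ → ℝ} (hc : ContinuousOn φ (dom T))
    (hb : BijOn φ (dom T) (Ici 0)) : IsTimeChange T φ := by
  refine ⟨?_, hb⟩
  obtain ⟨a, ha, ha0⟩ := hb.surjOn (mem_Ici.2 (le_refl (0 : ℝ)))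
  have h0 : (0 : ℝ) ∈ dom T := mem_dom_of_le le_rfl ha.1 ha
  intro s hs t ht hst
  -- On any `[0, b]` the map is strictly monotone; being unbounded, it cannot decrease.
  obtain ⟨b, hb', hb1⟩ := hb.surjOn (mem_Ici.2 (show (0 : ℝ) ≤ |φ 0| + |φ t| + 1 by positivity))
  set m := max b t with hm
  have hmd : m ∈ dom T := by
    rcases max_choice b t with h | h <;> rw [hm, h] <;> assumption
  have hsub : Icc 0 m ⊆ dom T := Icc_subset_dom hmd.2
  rcases (hc.mono hsub).strictMonoOn_of_injOn_Icc' hmd.1 (hb.injOn.mono hsub) with h | h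
  · exact h ⟨hs.1, hst.le.trans (le_max_right _ _)⟩ ⟨ht.1, le_max_right _ _⟩ hst
  · have h1 := h.antitoneOn ⟨le_rfl, hmd.1⟩ ⟨hb'.1, le_max_left _ _⟩ hb'.1
    rw [hb1] at h1
    linarith [le_abs_self (φ 0), abs_nonneg (φ t)]

/-- The element of the path space given by a continuous function on `[0, ∞)`. -/
noncomputable def toPath (f : ℝ → ℝ) (hf : ContinuousOn f (Ici 0)) (h0 : f 0 = 0) : PathSpace :=
  ⟨⟨fun x => f x, hf.comp_continuous NNReal.continuous_coe fun x => x.2⟩, by simpa using h0⟩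

theorem Z_toPath {f : ℝ → ℝ} (hf : ContinuousOn f (Ici 0)) (h0 : f 0 = 0) {x : ℝ} (hx : 0 ≤ x) :
    Z (toPath f hf h0) x = f x := by
  change f (x.toNNReal : ℝ) = f x
  rw [Real.coe_toNNReal x hx]

theorem continuous_Z (ω : PathSpace) : Continuous (Z ω) := by
  unfold Z
  fun_prop

theorem Z_zero (ω : PathSpace) : Z ω 0 = 0 := by
  simpa [Z] using ω.2

/-! ### The initial-value problem along a path -/

theorem continuous_drive (ε : ℝ) (ω : PathSpace) :
    Continuous fun p : ℝ × ℝ => drive ε ω p.1 p.2 := by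
  have := continuous_Z ω
  unfold drive
  fun_prop

theorem drive_lt_drive {ε : ℝ} (hε : 0 < ε) (ω : PathSpace) {s t : ℝ} (hst : s < t) (x : ℝ) :
    drive ε ω s x < drive ε ω t x := by
  unfold drive
  gcongr

theorem Icc_mem_nhdsWithin_dom (T : EReal) {t b : ℝ} (htb : t < b) : Icc 0 b ∈ 𝓝[dom T] t := by
  filter_upwards [self_mem_nhdsWithin, mem_nhdsWithin_of_mem_nhds (Iio_mem_nhds htb)] with s hs hs'
  exact ⟨hs.1, le_of_lt hs'⟩

namespace IsIVPSolution

variable {ε : ℝ} {ω : PathSpace} {T : EReal} {φ : ℝ → ℝ}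

theorem hasDerivWithinAt_Icc (h : IsIVPSolution ε ω T φ) {b : ℝ} (hb : (b : EReal) < T) :
    ∀ t ∈ Icc 0 b, HasDerivWithinAt φ (drive ε ω t (φ t)) (Icc 0 b) t := fun t ht =>
  (h.deriv t (Icc_subset_dom hb ht)).mono (Icc_subset_dom hb)

theorem continuousOn (h : IsIVPSolution ε ω T φ) : ContinuousOn φ (dom T) :=
  fun t ht => (h.deriv t ht).continuousWithinAt

theorem continuousOn_drive (h : IsIVPSolution ε ω T φ) :
    ContinuousOn (fun t => drive ε ω t (φ t)) (dom T) :=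
  (continuous_drive ε ω).comp_continuousOn (continuousOn_id.prodMk h.continuousOn)

/-- A shift by `η` adds `η / ε` to the drive, which pays for any excess of `ω` over `ω₂` smaller
than `η`. One path gives uniqueness and monotonicity; two paths give continuity in `ω`. -/
theorem le_comp_add {ω₂ : PathSpace} {T₂ : EReal} {φ₂ : ℝ → ℝ} (hε : 0 < ε)
    (h : IsIVPSolution ε ω T φ) (h₂ : IsIVPSolution ε ω₂ T₂ φ₂) {b η : ℝ} (hη : 0 ≤ η)
    (hb : b ∈ dom T) (hb₂ : ((b + η : ℝ) : EReal) < T₂)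
    (hω : ∀ t ∈ Icc 0 b, φ t = φ₂ (t + η) → Z ω (φ t) < Z ω₂ (φ t) + η) :
    φ b ≤ φ₂ (b + η) := by
  refine le_comp_add_of_lt hη (h.hasDerivWithinAt_Icc hb.2) (h₂.hasDerivWithinAt_Icc hb₂)
    ?_ ?_ b ⟨hb.1, le_rfl⟩
  · rw [h.zero]
    exact h₂.nonneg _ (mem_dom_of_le hη (le_add_of_nonneg_left hb.1)
      ⟨add_nonneg hb.1 hη, hb₂⟩)
  · intro t ht he
    have := hω t ht he
    unfold drive
    gcongr ε⁻¹ * ?_ + 1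
    linarith

theorem le_of_lt (hε : 0 < ε) (h : IsIVPSolution ε ω T φ) {T₂ : EReal} {φ₂ : ℝ → ℝ}
    (h₂ : IsIVPSolution ε ω T₂ φ₂) {s t : ℝ} (hs : s ∈ dom T) (ht : t ∈ dom T₂) (hst : s < t) :
    φ s ≤ φ₂ t := by
  have := h.le_comp_add hε h₂ (b := s) (η := t - s) (by linarith) hs
    (by simpa using ht.2) (fun u _ _ => by linarith)
  simpa using this

theorem le_of_mem (hε : 0 < ε) (h : IsIVPSolution ε ω T φ) {T₂ : EReal} {φ₂ : ℝ → ℝ}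
    (h₂ : IsIVPSolution ε ω T₂ φ₂) {t : ℝ} (ht : t ∈ dom T) (ht₂ : t ∈ dom T₂) :
    φ t ≤ φ₂ t := by
  have h1 : Tendsto φ₂ (𝓝[>] t) (𝓝 (φ₂ t)) :=
    (h₂.continuousOn t ht₂).mono_of_mem_nhdsWithin
      (nhdsWithin_mono _ Ioi_subset_Ici_self (dom_mem_nhdsGE ht₂))
  refine ge_of_tendsto h1 ?_
  filter_upwards [self_mem_nhdsWithin,
    nhdsWithin_mono _ Ioi_subset_Ici_self (dom_mem_nhdsGE ht₂)] with u hu hu'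
  exact h.le_of_lt hε h₂ ht hu' hu

theorem eq_of_mem (hε : 0 < ε) (h : IsIVPSolution ε ω T φ) {T₂ : EReal} {φ₂ : ℝ → ℝ}
    (h₂ : IsIVPSolution ε ω T₂ φ₂) {t : ℝ} (ht : t ∈ dom T) (ht₂ : t ∈ dom T₂) :
    φ t = φ₂ t :=
  (h.le_of_mem hε h₂ ht ht₂).antisymm (h₂.le_of_mem hε h ht₂ ht)

theorem drive_eq_zero_of_eqOn (h : IsIVPSolution ε ω T φ) {s t c : ℝ} (hs : 0 ≤ s)
    (ht : t ∈ dom T) (hc : ∀ u ∈ Icc s t, φ u = c) {u : ℝ} (hu : u ∈ Ioo s t) :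
    drive ε ω u c = 0 := by
  have h1 : HasDerivAt φ (drive ε ω u (φ u)) u :=
    (h.deriv u (mem_dom_of_le (hs.trans hu.1.le) hu.2.le ht)).hasDerivAt
      (dom_mem_nhds (mem_dom_of_le (hs.trans hu.1.le) hu.2.le ht) (hs.trans_lt hu.1))
  have h2 : HasDerivAt φ 0 u := (hasDerivAt_const u c).congr_of_eventuallyEq (by
    filter_upwards [Icc_mem_nhds hu.1 hu.2] with v hv using hc v hv)
  rw [← hc u ⟨hu.1.le, hu.2.le⟩]
  exact h1.unique h2

theorem strictMonoOn (hε : 0 < ε) (h : IsIVPSolution ε ω T φ) : StrictMonoOn φ (dom T) := by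
  intro s hs t ht hst
  refine lt_of_le_of_ne (h.le_of_lt hε h hs ht hst) fun he => ?_
  have hc : ∀ u ∈ Icc s t, φ u = φ s := by
    intro u hu
    have hud : u ∈ dom T := mem_dom_of_le (hs.1.trans hu.1) hu.2 ht
    rcases hu.1.eq_or_lt with rfl | h1
    · rfl
    rcases hu.2.eq_or_lt with rfl | h2
    · exact he.symm
    exact ((h.le_of_lt hε h hud ht h2).trans he.ge).antisymm (h.le_of_lt hε h hs hud h1)
  -- Two interior times of the flat stretch at which the drive vanishes at one level contradict its
  -- strict growth in time.
  have h1 := h.drive_eq_zero_of_eqOn hs.1 ht hc (u := (2 * s + t) / 3)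
    ⟨by linarith, by linarith⟩
  have h2 := h.drive_eq_zero_of_eqOn hs.1 ht hc (u := (s + 2 * t) / 3)
    ⟨by linarith, by linarith⟩
  have h3 := drive_lt_drive hε ω (show (2 * s + t) / 3 < (s + 2 * t) / 3 by linarith) (φ s)
  linarith

theorem drive_nonneg (hε : 0 < ε) (h : IsIVPSolution ε ω T φ) {t : ℝ} (ht : t ∈ dom T) :
    0 ≤ drive ε ω t (φ t) := by
  rw [← (h.deriv t ht).derivWithin (uniqueDiffWithinAt_dom ht)]
  exact (h.strictMonoOn hε).monotoneOn.derivWithin_nonneg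

end IsIVPSolution

/-- The drive is clamped at level `R + 1`. Up to the first time `τ` at which that level is reached
the clamp is inactive, and level `R` is passed before `τ`. -/
theorem exists_isIVPSolution {ε : ℝ} (hε : 0 < ε) (ω : PathSpace) {R : ℝ} (hR : 0 ≤ R) :
    ∃ (T : EReal) (φ : ℝ → ℝ), IsIVPSolution ε ω T φ ∧ ∃ t ∈ dom T, φ t = R := by
  have hZ := continuous_Z ω
  set g : ℝ → ℝ := fun x => ε⁻¹ * (Z ω x - x) + 1 with hgd
  have hg : Continuous g := by fun_prop
  have hg0 : 0 < g 0 := by simp [hgd, Z_zero]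
  have hc : 0 < ε⁻¹ := inv_pos.2 hε
  obtain ⟨M, hM⟩ := (isCompact_Icc (a := 0) (b := R + 1)).exists_bound_of_continuousOn
    hg.continuousOn
  have hM0 : 0 ≤ M := (norm_nonneg _).trans (hM 0 ⟨le_rfl, by linarith⟩)
  -- From `φ' ≥ ε⁻¹ t - M` follows `φ N ≥ N (N / (2ε) - M)`, and this `N` makes the bracket at least
  -- `R + 1`.
  set N : ℝ := 2 * (M + (R + 1)) * ε + 1 with hN
  have hN1 : 1 ≤ N := by
    have : 0 ≤ 2 * (M + (R + 1)) * ε := by positivity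
    linarith
  obtain ⟨φ, hφ0, hφn, hφ⟩ := exists_solution_of_continuous hg (R := R + 1) (by linarith) hg0 hc
    (zero_le_one.trans hN1)
  have hφc : ContinuousOn φ (Icc 0 N) := fun t ht => (hφ t ht).continuousWithinAt
  have hend : R + 1 ≤ φ N := by
    have hmono : MonotoneOn (fun t => φ t - (ε⁻¹ / 2 * t ^ 2 - M * t)) (Icc 0 N) := by
      refine monotoneOn_of_hasDerivWithinAt_nonneg (convex_Icc 0 N)
        (f' := fun t => g (max 0 (min (R + 1) (φ t))) + ε⁻¹ * t - (ε⁻¹ / 2 * (2 * t) - M))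
        (hφc.sub (by fun_prop)) (fun t ht => ?_) (fun t ht => ?_)
      · refine ((hφ t (interior_subset ht)).mono interior_subset).sub ?_
        have h1 := (((hasDerivAt_pow 2 t).const_mul (ε⁻¹ / 2)).sub
          ((hasDerivAt_id t).const_mul M)).hasDerivWithinAt (s := interior (Icc 0 N))
        simpa [Pi.sub_def] using h1
      · have := (abs_le.1 (hM (max 0 (min (R + 1) (φ t)))
          ⟨le_max_left _ _, max_le (by linarith) (min_le_left _ _)⟩)).1
        linarith
    have h1 := hmono ⟨le_rfl, by linarith⟩ ⟨by linarith, le_rfl⟩ (show (0 : ℝ) ≤ N by linarith)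
    simp only [hφ0] at h1
    have h2 : ε⁻¹ / 2 * N = M + (R + 1) + ε⁻¹ / 2 := by rw [hN]; field_simp
    have h3 : ε⁻¹ / 2 * N ^ 2 - M * N = (R + 1 + ε⁻¹ / 2) * N := by
      rw [sq, ← mul_assoc, h2]; ring
    have h4 : (R + 1) * 1 ≤ (R + 1 + ε⁻¹ / 2) * N :=
      mul_le_mul (by linarith) hN1 zero_le_one (by linarith)
    linarith
  have hcl : IsClosed (Icc 0 N ∩ φ ⁻¹' Ici (R + 1)) :=
    hφc.preimage_isClosed_of_isClosed isClosed_Icc isClosed_Ici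
  obtain ⟨τ, ⟨hτ, hτR⟩, hτmin⟩ := (isCompact_Icc.of_isClosed_subset hcl
    inter_subset_left).exists_isLeast ⟨N, ⟨by linarith, le_rfl⟩, hend⟩
  have hτR' : R + 1 ≤ φ τ := hτR
  have hτ0 : 0 < τ := hτ.1.lt_of_ne fun h => by rw [← h, hφ0] at hτR'; linarith
  have hdom : ∀ {t : ℝ}, t ∈ dom (τ : EReal) ↔ 0 ≤ t ∧ t < τ := by simp [dom]
  have hsub : dom (τ : EReal) ⊆ Icc 0 N := fun t ht =>
    ⟨ht.1, (hdom.1 ht).2.le.trans hτ.2⟩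
  refine ⟨τ, φ, ⟨by exact_mod_cast hτ0, hφ0, fun t ht => hφn t (hsub ht), fun t ht => ?_⟩, ?_⟩
  · have hlt : φ t < R + 1 := by
      by_contra! hge
      exact absurd (hτmin ⟨hsub ht, hge⟩) (not_le.2 (hdom.1 ht).2)
    have h1 := (hφ t (hsub ht)).mono hsub
    rw [min_eq_right hlt.le, max_eq_right (hφn t (hsub ht))] at h1
    have he : drive ε ω t (φ t) = g (φ t) + ε⁻¹ * t := by simp only [drive, hgd]; ring
    rwa [he]
  · obtain ⟨t, ht, htR⟩ := intermediate_value_Icc hτ.1 (hφc.mono (Icc_subset_Icc_right hτ.2))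
      (show R ∈ Icc (φ 0) (φ τ) from ⟨by rwa [hφ0], by linarith⟩)
    refine ⟨t, hdom.2 ⟨ht.1, ht.2.lt_of_ne fun h => ?_⟩, htR⟩
    rw [h] at htR
    linarith

/-! ### The maximal solution -/

/-- The life time of the maximal solution of the initial-value problem. -/
noncomputable def lifeTime (ε : ℝ) (ω : PathSpace) : EReal :=
  sSup {T | ∃ φ, IsIVPSolution ε ω T φ}

open Classical in
/-- The maximal solution of the initial-value problem. -/
noncomputable def flow (ε : ℝ) (ω : PathSpace) (t : ℝ) : ℝ :=
  if h : ∃ φ : ℝ → ℝ, ∃ T : EReal, IsIVPSolution ε ω T φ ∧ (t : EReal) < T then h.choose t else 0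

theorem IsIVPSolution.eqOn_flow {ε : ℝ} (hε : 0 < ε) {ω : PathSpace} {T : EReal} {φ : ℝ → ℝ}
    (h : IsIVPSolution ε ω T φ) : EqOn φ (flow ε ω) (dom T) := by
  intro t ht
  have he : ∃ φ : ℝ → ℝ, ∃ T : EReal, IsIVPSolution ε ω T φ ∧ (t : EReal) < T := ⟨φ, T, h, ht.2⟩
  rw [flow, dif_pos he]
  obtain ⟨T', h', ht'⟩ := he.choose_spec
  exact h.eq_of_mem hε h' ht ⟨ht.1, ht'⟩

theorem IsIVPSolution.le_lifeTime {ε : ℝ} {ω : PathSpace} {T : EReal} {φ : ℝ → ℝ}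
    (h : IsIVPSolution ε ω T φ) : T ≤ lifeTime ε ω := le_sSup ⟨φ, h⟩

section Flow

variable {ε : ℝ} (hε : 0 < ε) (ω : PathSpace)
include hε

/-- By uniqueness all solutions agree on common domains and glue together. -/
theorem isIVPSolution_flow : IsIVPSolution ε ω (lifeTime ε ω) (flow ε ω) := by
  obtain ⟨T₀, φ₀, h₀, -⟩ := exists_isIVPSolution hε ω le_rfl
  have key : ∀ t ∈ dom (lifeTime ε ω), ∃ T φ, IsIVPSolution ε ω T φ ∧ t ∈ dom T := by
    intro t ht
    obtain ⟨T, ⟨φ, h⟩, hT⟩ := lt_sSup_iff.1 ht.2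
    exact ⟨T, φ, h, ht.1, hT⟩
  refine ⟨h₀.pos.trans_le h₀.le_lifeTime, ?_, fun t ht => ?_, fun t ht => ?_⟩
  · rw [← h₀.eqOn_flow hε (zero_mem_dom h₀.pos), h₀.zero]
  · obtain ⟨T, φ, h, hT⟩ := key t ht
    rw [← h.eqOn_flow hε hT]
    exact h.nonneg t hT
  · obtain ⟨T, φ, h, hT⟩ := key t ht
    have h1 : HasDerivWithinAt (flow ε ω) (drive ε ω t (flow ε ω t)) (dom T) t := by
      rw [← h.eqOn_flow hε hT]
      exact (h.deriv t hT).congr (fun s hs => (h.eqOn_flow hε hs).symm) (h.eqOn_flow hε hT).symm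
    -- The shorter interval is a neighbourhood of `t` within the longer one, so the derivative does
    -- not see the difference.
    refine h1.mono_of_mem_nhdsWithin ?_
    obtain ⟨u, hu, htu⟩ := exists_gt_mem_dom' hT
    exact mem_of_superset (Icc_mem_nhdsWithin_dom _ htu) (Icc_subset_dom hu.2)

theorem isTimeChange_flow : IsTimeChange (lifeTime ε ω) (flow ε ω) := by
  have h := isIVPSolution_flow hε ω
  refine ⟨h.strictMonoOn hε, fun t ht => h.nonneg t ht, (h.strictMonoOn hε).injOn, ?_⟩
  intro R hR
  obtain ⟨T, φ, h', t, ht, rfl⟩ := exists_isIVPSolution hε ω hR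
  exact ⟨t, dom_mono h'.le_lifeTime ht, (h'.eqOn_flow hε ht).symm⟩

/-- The volatility path: the solution of the time-change equation. -/
noncomputable def vol (ε : ℝ) (ω : PathSpace) (t : ℝ) : ℝ := drive ε ω t (flow ε ω t)

end Flow

/-! ### The time-change equation -/

theorem IsTCEPath.eq_drive {ε : ℝ} (hε : 0 < ε) {ω : PathSpace} {T : EReal} {X : ℝ → ℝ}
    (h : IsTCEPath ε ω T X) {t : ℝ} (ht : t ∈ dom T) : X t = drive ε ω t (timeAvg X t) := by
  unfold drive
  rw [← h.eqn t ht]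
  field_simp
  ring

/-- `X` is only assumed integrable, but its average is continuous, and the equation writes `X` as a
continuous function of time and average. So `X` is continuous and is the derivative of its average.
-/
theorem IsTCEPath.isIVPSolution {ε : ℝ} (hε : 0 < ε) {ω : PathSpace} {T : EReal} {X : ℝ → ℝ}
    (h : IsTCEPath ε ω T X) : IsIVPSolution ε ω T (timeAvg X) where
  pos := h.pos
  zero := by simp [timeAvg]
  nonneg := h.nonneg
  deriv t ht := by
    obtain ⟨b, hb, htb⟩ := exists_gt_mem_dom' ht
    have hsub := Icc_subset_dom hb.2
    have hc : ContinuousOn (timeAvg X) (Icc 0 b) := by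
      have := intervalIntegral.continuousOn_primitive_interval (f := X) (μ := volume)
        (a := 0) (b := b) (by
          rw [uIcc_of_le hb.1, integrableOn_Icc_iff_integrableOn_Ioc]
          exact (intervalIntegrable_iff_integrableOn_Ioc_of_le hb.1).1 (h.integrable b hb))
      rwa [uIcc_of_le hb.1] at this
    have hX : ContinuousOn X (Icc 0 b) :=
      ((continuous_drive ε ω).comp_continuousOn (continuousOn_id.prodMk hc)).congr
        fun s hs => h.eq_drive hε (hsub hs)
    have : Fact (t ∈ Icc 0 b) := ⟨⟨ht.1, htb.le⟩⟩
    have h1 := intervalIntegral.integral_hasDerivWithinAt_right (s := Icc 0 b) (t := Icc 0 b)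
      (h.integrable t ht)
      (hX.stronglyMeasurableAtFilter_nhdsWithin measurableSet_Icc t) (hX t ⟨ht.1, htb.le⟩)
    rw [← h.eq_drive hε ht]
    exact h1.mono_of_mem_nhdsWithin (Icc_mem_nhdsWithin_dom T htb)

theorem IsIVPSolution.timeAvg_drive {ε : ℝ} {ω : PathSpace} {T : EReal} {φ : ℝ → ℝ}
    (h : IsIVPSolution ε ω T φ) {t : ℝ} (ht : t ∈ dom T) :
    timeAvg (fun s => drive ε ω s (φ s)) t = φ t := by
  have := integral_eq_of_hasDerivWithinAt (h.hasDerivWithinAt_Icc ht.2)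
    (h.continuousOn_drive.mono (Icc_subset_dom ht.2)) ⟨ht.1, le_rfl⟩
  rwa [h.zero, sub_zero] at this

theorem IsIVPSolution.isTCEPath {ε : ℝ} (hε : 0 < ε) {ω : PathSpace} {T : EReal} {φ : ℝ → ℝ}
    (h : IsIVPSolution ε ω T φ) : IsTCEPath ε ω T (fun t => drive ε ω t (φ t)) where
  pos := h.pos
  integrable t ht := by
    refine (h.continuousOn_drive.mono ?_).intervalIntegrable
    rw [uIcc_of_le ht.1]
    exact Icc_subset_dom ht.2
  nonneg t ht := by
    rw [h.timeAvg_drive ht]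
    exact h.nonneg t ht
  eqn t ht := by
    rw [h.timeAvg_drive ht]
    unfold drive
    field_simp
    ring

section Vol

variable {ε : ℝ} (hε : 0 < ε) (ω : PathSpace)
include hε

theorem isTCEPath_vol : IsTCEPath ε ω (lifeTime ε ω) (vol ε ω) :=
  (isIVPSolution_flow hε ω).isTCEPath hε

theorem eqOn_timeAvg_vol : EqOn (timeAvg (vol ε ω)) (flow ε ω) (dom (lifeTime ε ω)) :=
  fun _ ht => (isIVPSolution_flow hε ω).timeAvg_drive ht

theorem isIVPSolution_timeAvg_vol : IsIVPSolution ε ω (lifeTime ε ω) (timeAvg (vol ε ω)) :=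
  (isTCEPath_vol hε ω).isIVPSolution hε

theorem isTimeChange_timeAvg_vol : IsTimeChange (lifeTime ε ω) (timeAvg (vol ε ω)) :=
  ⟨(isTimeChange_flow hε ω).strictMonoOn.congr (eqOn_timeAvg_vol hε ω).symm,
    (isTimeChange_flow hε ω).bijOn.congr (eqOn_timeAvg_vol hε ω).symm⟩

theorem vol_eq_drive {t : ℝ} (ht : t ∈ dom (lifeTime ε ω)) :
    vol ε ω t = drive ε ω t (timeAvg (vol ε ω) t) := (isTCEPath_vol hε ω).eq_drive hε ht

theorem IsIVPSolution.eqOn_timeAvg_vol {ω : PathSpace} {T : EReal} {φ : ℝ → ℝ}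
    (h : IsIVPSolution ε ω T φ) : EqOn φ (timeAvg (vol ε ω)) (dom T) := fun t ht => by
  rw [CIR.eqOn_timeAvg_vol hε ω (dom_mono h.le_lifeTime ht), h.eqOn_flow hε ht]

theorem IsTCEPath.le_lifeTime {ω : PathSpace} {T : EReal} {X : ℝ → ℝ}
    (h : IsTCEPath ε ω T X) : T ≤ lifeTime ε ω := (h.isIVPSolution hε).le_lifeTime

theorem IsTCEPath.eqOn_vol {ω : PathSpace} {T : EReal} {X : ℝ → ℝ}
    (h : IsTCEPath ε ω T X) : EqOn X (vol ε ω) (dom T) := fun t ht => by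
  rw [h.eq_drive hε ht, (h.isIVPSolution hε).eqOn_flow hε ht, vol]

theorem interior_setOf_vol_eq_zero :
    interior {t | t ∈ dom (lifeTime ε ω) ∧ vol ε ω t = 0} = ∅ := by
  refine eq_empty_of_forall_notMem fun t ht => ?_
  obtain ⟨l, u, ⟨hlu, htu⟩, hsub⟩ := mem_nhds_iff_exists_Ioo_subset.1 (mem_interior_iff_mem_nhds.1 ht)
  have htm := interior_subset ht
  have hlt : t < (t + u) / 2 := by linarith
  have hmem : ∀ s ∈ Icc t ((t + u) / 2), s ∈ dom (lifeTime ε ω) ∧ vol ε ω s = 0 := by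
    intro s hs
    rcases hs.1.eq_or_lt with rfl | h
    · exact htm
    · exact hsub ⟨hlu.trans h, by linarith [hs.2]⟩
  have hflow := isIVPSolution_flow hε ω
  have h1 := constant_of_has_deriv_right_zero (f := flow ε ω) (a := t) (b := (t + u) / 2)
    (hflow.continuousOn.mono fun s hs => (hmem s hs).1) (fun s hs => by
      have hs' := hmem s (Ico_subset_Icc_self hs)
      have h2 := (hflow.deriv s hs'.1).mono_of_mem_nhdsWithin (dom_mem_nhdsGE hs'.1)
      rwa [show drive ε ω s (flow ε ω s) = 0 from hs'.2] at h2)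
    _ ⟨hlt.le, le_rfl⟩
  exact (hflow.strictMonoOn hε htm.1 (hmem _ ⟨hlt.le, le_rfl⟩).1 hlt).ne' h1

end Vol

/-! ### Bounds and continuity of the exit times -/

section ExitBounds

variable {ε : ℝ} {ω : PathSpace} {T : EReal} {φ : ℝ → ℝ}

/-- This is `φ' ≥ 0` at the time when level `u` is reached, multiplied by `ε`. -/
theorem IsIVPSolution.sub_le_exit (hε : 0 < ε) (h : IsIVPSolution ε ω T φ)
    (hb : IsTimeChange T φ) {u : ℝ} (hu : 0 ≤ u) : eSubZ ω u - ε ≤ exit T φ u := by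
  have h1 := h.drive_nonneg hε (hb.exit_mem hu)
  rw [hb.apply_exit hu] at h1
  have h2 : 0 ≤ ε * drive ε ω (exit T φ u) u := mul_nonneg hε.le h1
  have h3 : ε * drive ε ω (exit T φ u) u = Z ω u + exit T φ u - u + ε := by
    unfold drive
    field_simp
  rw [h3] at h2
  unfold eSubZ
  linarith

/-- Before level `x` is reached, `e - Z` along `φ` is at most `a`, so `φ' ≥ (t - a) / ε`.
Integrating from `a` to the exit time `y` gives `(y - a)² ≤ 2xε`. -/
theorem IsIVPSolution.exit_le (hε : 0 < ε) (h : IsIVPSolution ε ω T φ)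
    (hb : IsTimeChange T φ) {x a : ℝ} (hx : 0 ≤ x) (ha : 0 ≤ a)
    (hS : ∀ u, 0 ≤ u → u < x → eSubZ ω u ≤ a) : exit T φ x ≤ a + 2 * √(x * ε) := by
  set y := exit T φ x with hy
  have hymem : y ∈ dom T := hb.exit_mem hx
  rcases le_or_gt y a with hya | hay
  · linarith [Real.sqrt_nonneg (x * ε)]
  have hsub : Icc a y ⊆ dom T := fun t ht => mem_dom_of_le (ha.trans ht.1) ht.2 hymem
  have hmono : MonotoneOn (fun t => φ t - ε⁻¹ / 2 * (t - a) ^ 2) (Icc a y) := by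
    refine monotoneOn_of_hasDerivWithinAt_nonneg (convex_Icc a y)
      (f' := fun t => drive ε ω t (φ t) - ε⁻¹ / 2 * (2 * (t - a)))
      ((h.continuousOn.mono hsub).sub (by fun_prop)) (fun t ht => ?_) (fun t ht => ?_)
    · refine ((h.deriv t (hsub (interior_subset ht))).mono (interior_subset.trans hsub)).sub ?_
      have h1 := ((((hasDerivAt_id t).sub_const a).pow 2).const_mul
        (ε⁻¹ / 2)).hasDerivWithinAt (s := interior (Icc a y))
      simpa using h1
    · rw [interior_Icc] at ht
      have htd := hsub (Ioo_subset_Icc_self ht)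
      have h1 := hS (φ t) (h.nonneg t htd) ((hb.lt_exit_iff htd hx).1 ht.2)
      have h2 : drive ε ω t (φ t) - ε⁻¹ / 2 * (2 * (t - a)) =
          ε⁻¹ * (a - eSubZ ω (φ t)) + 1 := by
        unfold drive eSubZ
        ring
      rw [h2]
      have := mul_nonneg (inv_pos.2 hε).le (sub_nonneg.2 h1)
      linarith
  have h1 := hmono ⟨le_rfl, hay.le⟩ ⟨hay.le, le_rfl⟩ hay.le
  simp only [hy, hb.apply_exit hx, sub_self] at h1
  rw [← hy] at h1
  have h2 := h.nonneg a (hsub ⟨le_rfl, hay.le⟩)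
  have h3 : ((y - a) / 2) ^ 2 ≤ x * ε := by
    have h4 : ε⁻¹ / 2 * (y - a) ^ 2 ≤ x := by linarith
    have h5 : (y - a) ^ 2 / 2 ≤ x * ε := by
      calc (y - a) ^ 2 / 2 = ε⁻¹ / 2 * (y - a) ^ 2 * ε := by field_simp
        _ ≤ x * ε := by gcongr
    linarith [sq_nonneg (y - a), div_pow (y - a) 2 2]
  have h6 := (Real.le_sqrt' (show 0 < (y - a) / 2 by linarith)).2 h3
  linarith

/-- Until its exit time `φ` stays in `[0, x]`, so only the paths on `[0, x]` matter. -/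
theorem IsIVPSolution.exit_le_exit_add (hε : 0 < ε) (h : IsIVPSolution ε ω T φ)
    (hb : IsTimeChange T φ) {ω₂ : PathSpace} {T₂ : EReal} {φ₂ : ℝ → ℝ}
    (h₂ : IsIVPSolution ε ω₂ T₂ φ₂) (hb₂ : IsTimeChange T₂ φ₂) {x η : ℝ} (hx : 0 ≤ x)
    (hη : 0 ≤ η) (hω : ∀ u ∈ Icc 0 x, Z ω u < Z ω₂ u + η) :
    exit T₂ φ₂ x ≤ exit T φ x + η := by
  by_contra! hlt
  have hm := hb.exit_mem hx
  have hm₂ := mem_dom_of_le (add_nonneg hm.1 hη) hlt.le (hb₂.exit_mem hx)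
  have h1 := h.le_comp_add hε h₂ hη hm hm₂.2 fun t ht _ => hω _ ⟨h.nonneg t
    (mem_dom_of_le ht.1 ht.2 hm), by
      rw [← hb.apply_exit hx]
      exact hb.strictMonoOn.monotoneOn (mem_dom_of_le ht.1 ht.2 hm) hm ht.2⟩
  rw [hb.apply_exit hx] at h1
  exact absurd ((hb₂.lt_exit_iff hm₂ hx).1 hlt) (not_lt.2 h1)

end ExitBounds

/-! ### Convergence in the path space and measurability in the path -/

theorem tendsto_path_iff {ι : Type*} {l : Filter ι} {F : ι → PathSpace} {f : PathSpace} :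
    Tendsto F l (𝓝 f) ↔ ∀ x, 0 ≤ x → ∀ δ > 0,
      ∀ᶠ i in l, ∀ u ∈ Icc 0 x, |Z (F i) u - Z f u| < δ := by
  have h0 : Tendsto F l (𝓝 f) ↔ Tendsto (fun i => (F i).1) l (𝓝 f.1) := tendsto_subtype_rng
  rw [h0, ContinuousMap.tendsto_iff_forall_isCompact_tendstoUniformlyOn]
  constructor
  · intro h x hx δ hδ
    filter_upwards [Metric.tendstoUniformlyOn_iff.1 (h (Icc 0 x.toNNReal) isCompact_Icc) δ hδ]
      with i hi u hu
    have := hi u.toNNReal ⟨bot_le, Real.toNNReal_le_toNNReal hu.2⟩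
    rwa [dist_comm, Real.dist_eq] at this
  · intro h K hK
    refine Metric.tendstoUniformlyOn_iff.2 fun δ hδ => ?_
    obtain ⟨b, hb⟩ := hK.bddAbove
    filter_upwards [h b b.2 δ hδ] with i hi u hu
    have := hi u ⟨u.2, by exact_mod_cast hb hu⟩
    rw [dist_comm, Real.dist_eq]
    simpa [Z] using this

section Measurability

variable {ε : ℝ} (hε : 0 < ε)
include hε

theorem continuous_exit {x : ℝ} (hx : 0 ≤ x) :
    Continuous fun ω => exit (lifeTime ε ω) (flow ε ω) x := by
  refine continuous_iff_continuousAt.2 fun ω => Metric.tendsto_nhds.2 fun δ hδ => ?_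
  filter_upwards [tendsto_path_iff.1 (tendsto_id (α := PathSpace) (x := 𝓝 ω)) x hx (δ / 2)
    (half_pos hδ)] with ω' hω'
  have hlt : ∀ u ∈ Icc 0 x, Z ω u < Z ω' u + δ / 2 ∧ Z ω' u < Z ω u + δ / 2 := fun u hu => by
    have := abs_lt.1 (hω' u hu)
    simp only [id] at this
    constructor <;> linarith
  have h1 := (isIVPSolution_flow hε ω).exit_le_exit_add hε (isTimeChange_flow hε ω)
    (isIVPSolution_flow hε ω') (isTimeChange_flow hε ω') hx (half_pos hδ).le
    fun u hu => (hlt u hu).1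
  have h2 := (isIVPSolution_flow hε ω').exit_le_exit_add hε (isTimeChange_flow hε ω')
    (isIVPSolution_flow hε ω) (isTimeChange_flow hε ω) hx (half_pos hδ).le
    fun u hu => (hlt u hu).2
  rw [Real.dist_eq, abs_lt]
  constructor <;> linarith

theorem lifeTime_eq_iSup (ω : PathSpace) :
    lifeTime ε ω = ⨆ n : ℕ, (exit (lifeTime ε ω) (flow ε ω) n : EReal) := by
  have h := isTimeChange_flow hε ω
  refine le_antisymm (le_of_forall_lt fun c hc => ?_)
    (iSup_le fun n => (h.exit_mem n.cast_nonneg).2.le)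
  obtain ⟨t, hct, htT⟩ := EReal.lt_iff_exists_real_btwn.1 hc
  have hmem : max t 0 ∈ dom (lifeTime ε ω) := by
    rcases max_choice t 0 with h' | h' <;> rw [h']
    · exact ⟨by rw [← h']; exact le_max_right _ _, htT⟩
    · exact zero_mem_dom h.pos
  obtain ⟨n, hn⟩ := exists_nat_gt (flow ε ω (max t 0))
  refine hct.trans_le (le_iSup_of_le n (EReal.coe_le_coe_iff.2 ?_))
  exact (le_max_left _ _).trans ((h.lt_exit_iff hmem n.cast_nonneg).2 hn).le

theorem measurable_lifeTime : Measurable (lifeTime ε) := by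
  have : lifeTime ε = fun ω => ⨆ n : ℕ, (exit (lifeTime ε ω) (flow ε ω) n : EReal) :=
    funext (lifeTime_eq_iSup hε)
  rw [this]
  exact Measurable.iSup fun n =>
    measurable_coe_real_ereal.comp (continuous_exit hε n.cast_nonneg).measurable

theorem measurableSet_lt_lifeTime (t : ℝ) : MeasurableSet {ω | (t : EReal) < lifeTime ε ω} :=
  measurableSet_lt measurable_const (measurable_lifeTime hε)

theorem measurable_flow {t : ℝ} (ht : 0 ≤ t) :
    Measurable ({ω | (t : EReal) < lifeTime ε ω}.indicator fun ω => flow ε ω t) := by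
  refine measurable_of_Iic fun x => ?_
  -- The sublevel set is empty for `x < 0`. For `x ≥ 0` it is the event that the life time has
  -- passed, where the indicator is `0`, or that level `x` is exited no earlier than `t`.
  rcases lt_or_ge x 0 with hx | hx
  · convert MeasurableSet.empty
    refine eq_empty_of_forall_notMem fun ω hω => ?_
    have h0 : 0 ≤ {ω | (t : EReal) < lifeTime ε ω}.indicator (fun ω => flow ε ω t) ω :=
      indicator_apply_nonneg (fun hω => (isIVPSolution_flow hε ω).nonneg t ⟨ht, hω⟩)
    exact absurd (h0.trans hω) (not_le.2 hx)
  · convert (measurableSet_lt_lifeTime hε t).compl.union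
      (measurableSet_le measurable_const (continuous_exit hε hx).measurable :
        MeasurableSet {ω | t ≤ exit (lifeTime ε ω) (flow ε ω) x})
    ext ω
    by_cases hω : (t : EReal) < lifeTime ε ω
    · have h1 := (isTimeChange_flow hε ω).exit_lt_iff ⟨ht, hω⟩ hx
      simp [hω, ← not_lt, h1]
    · simp [hω, hx]

theorem measurable_vol {t : ℝ} (ht : 0 ≤ t) :
    Measurable ({ω | (t : EReal) < lifeTime ε ω}.indicator fun ω => vol ε ω t) := by
  set Φ := {ω | (t : EReal) < lifeTime ε ω}.indicator fun ω => flow ε ω t with hΦ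
  have hm : Measurable Φ := measurable_flow hε ht
  have heq : ({ω | (t : EReal) < lifeTime ε ω}.indicator fun ω => vol ε ω t) =
      {ω | (t : EReal) < lifeTime ε ω}.indicator fun ω => drive ε ω t (Φ ω) := by
    refine indicator_congr fun ω hω => ?_
    rw [hΦ, indicator_of_mem hω, vol]
  rw [heq]
  refine Measurable.indicator ?_ (measurableSet_lt_lifeTime hε t)
  -- Joint continuity of evaluation makes the path measurable at a random level.
  have hev : Continuous fun p : PathSpace × ℝ≥0 => p.1.1 p.2 :=
    (continuous_subtype_val.comp continuous_fst).eval continuous_snd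
  have hZ : Measurable fun ω => Z ω (Φ ω) :=
    hev.measurable.comp (measurable_id.prodMk hm.real_toNNReal)
  unfold drive
  fun_prop

theorem isTCEProcess_vol : IsTCEProcess ε (lifeTime ε) (vol ε) where
  measurable_life := measurable_lifeTime hε
  measurable _ ht := measurable_vol hε ht
  path := isTCEPath_vol hε

end Measurability

/-! ### Right-continuous inverses and their completed graphs -/

/-- `e` is, on `[0, ζ)`, the right-continuous inverse of the nondecreasing path `m`. -/
structure IsRightContInverse (ζ : EReal) (m : PathSpace) (e : ℝ → ℝ) : Prop where
  mono : MonotoneOn (Z m) (Ici 0)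
  le_iff : ∀ t ∈ dom ζ, ∀ z, 0 ≤ z → (z ≤ e t ↔ Z m z ≤ t)

namespace IsRightContInverse

variable {ζ : EReal} {m : PathSpace} {e : ℝ → ℝ} (h : IsRightContInverse ζ m e)
include h

theorem nonneg {t : ℝ} (ht : t ∈ dom ζ) : 0 ≤ e t :=
  (h.le_iff t ht 0 le_rfl).2 (by rw [Z_zero]; exact ht.1)

theorem Z_nonneg {z : ℝ} (hz : 0 ≤ z) : 0 ≤ Z m z := by
  simpa [Z_zero] using h.mono (mem_Ici.2 le_rfl) hz hz

theorem lt_iff {t z : ℝ} (ht : t ∈ dom ζ) (hz : 0 ≤ z) : e t < z ↔ t < Z m z := by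
  rw [← not_le, h.le_iff t ht z hz, not_le]

theorem Z_apply {t : ℝ} (ht : t ∈ dom ζ) : Z m (e t) = t := by
  refine le_antisymm ((h.le_iff t ht _ (h.nonneg ht)).1 le_rfl) ?_
  refine ge_of_tendsto (((continuous_Z m).tendsto (e t)).mono_left
    (nhdsWithin_le_nhds (s := Ioi (e t)))) ?_
  filter_upwards [self_mem_nhdsWithin] with z hz
  exact ((h.lt_iff ht ((h.nonneg ht).trans (le_of_lt hz))).1 hz).le

theorem monotoneOn : MonotoneOn e (dom ζ) := fun s hs t ht hst => by
  rw [h.le_iff t ht _ (h.nonneg hs), h.Z_apply hs]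
  exact hst

theorem continuousWithinAt_Ici {t : ℝ} (ht : t ∈ dom ζ) : ContinuousWithinAt e (Ici t) t := by
  refine tendsto_order.2 ⟨fun a ha => ?_, fun b hb => ?_⟩
  · filter_upwards [dom_mem_nhdsGE ht, self_mem_nhdsWithin] with s hs hts
    exact ha.trans_le (h.monotoneOn ht hs hts)
  · have hb0 := (h.nonneg ht).trans hb.le
    filter_upwards [dom_mem_nhdsGE ht,
      mem_nhdsWithin_of_mem_nhds (gt_mem_nhds ((h.lt_iff ht hb0).1 hb))] with s hs hsb
    exact (h.lt_iff hs hb0).2 hsb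

theorem exists_isLeast {s : ℝ} (hs : s ∈ dom ζ) : ∃ l, IsLeast {z | 0 ≤ z ∧ Z m z = s} l := by
  have hcl : IsClosed (Icc 0 (e s) ∩ Z m ⁻¹' {s}) :=
    isClosed_Icc.inter (isClosed_singleton.preimage (continuous_Z m))
  obtain ⟨l, hl, hmin⟩ := (isCompact_Icc.of_isClosed_subset hcl inter_subset_left).exists_isLeast
    ⟨e s, ⟨h.nonneg hs, le_rfl⟩, h.Z_apply hs⟩
  exact ⟨l, ⟨hl.1.1, hl.2⟩, fun z hz =>
    hmin ⟨⟨hz.1, (h.le_iff s hs z hz.1).2 hz.2.le⟩, hz.2⟩⟩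

/-- A jump of `e` at `s` is a flat stretch of `m` at height `s`: `e` jumps from its left end to its
right end. -/
theorem tendsto_nhdsLT {s l : ℝ} (hs : s ∈ dom ζ) (hs0 : 0 < s)
    (hl : IsLeast {z | 0 ≤ z ∧ Z m z = s} l) : Tendsto e (𝓝[<] s) (𝓝 l) := by
  obtain ⟨⟨hl0, hls⟩, hmin⟩ := hl
  have hdom : ∀ᶠ t in 𝓝[<] s, t ∈ dom ζ ∧ t < s := by
    filter_upwards [self_mem_nhdsWithin, mem_nhdsWithin_of_mem_nhds (lt_mem_nhds hs0)] with t ht ht'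
    exact ⟨mem_dom_of_le (le_of_lt ht') (le_of_lt ht) hs, ht⟩
  refine tendsto_order.2 ⟨fun a ha => ?_, fun b hb => ?_⟩
  · rcases lt_or_ge a 0 with ha0 | ha0
    · filter_upwards [hdom] with t ht using ha0.trans_le (h.nonneg ht.1)
    · obtain ⟨c, hac, hcl⟩ := exists_between ha
      have hc0 := ha0.trans hac.le
      have hcs : Z m c < s := by
        refine lt_of_le_of_ne (hls ▸ h.mono hc0 hl0 hcl.le) fun hc => ?_
        exact absurd (hmin ⟨hc0, hc⟩) (not_le.2 hcl)
      filter_upwards [hdom, mem_nhdsWithin_of_mem_nhds (lt_mem_nhds hcs)] with t ht hct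
      exact hac.trans_le ((h.le_iff t ht.1 c hc0).2 (le_of_lt hct))
  · filter_upwards [hdom] with t ht
    refine lt_trans ((h.lt_iff ht.1 hl0).2 ?_) hb
    rw [hls]
    exact ht.2

theorem isCadlagOn : IsCadlagOn ζ e := fun _ ht =>
  ⟨h.continuousWithinAt_Ici ht, fun ht0 =>
    let ⟨l, hl⟩ := h.exists_isLeast ht
    ⟨l, h.tendsto_nhdsLT ht ht0 hl⟩⟩

theorem isLeast_leftValue {s : ℝ} (hs : s ∈ dom ζ) :
    IsLeast {z | 0 ≤ z ∧ Z m z = s} (leftValue e s) := by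
  rcases hs.1.eq_or_lt with rfl | hs0
  -- The convention `x(0-) = 0` fits because `m` starts from zero; an initial flat stretch of `m`
  -- then becomes a jump at the origin.
  · simpa [leftValue] using ⟨⟨le_rfl, Z_zero m⟩, fun z hz => hz.1⟩
  · obtain ⟨l, hl⟩ := h.exists_isLeast hs
    rw [leftValue, if_neg (not_le.2 hs0), leftLim_eq_of_tendsto (h.tendsto_nhdsLT hs hs0 hl)]
    exact hl

theorem mem_uIcc_iff {s z : ℝ} (hs : s ∈ dom ζ) :
    z ∈ uIcc (leftValue e s) (e s) ↔ 0 ≤ z ∧ Z m z = s := by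
  have hl := h.isLeast_leftValue hs
  rw [uIcc_of_le (hl.2 ⟨h.nonneg hs, h.Z_apply hs⟩)]
  constructor
  · rintro ⟨h1, h2⟩
    have hz0 := hl.1.1.trans h1
    exact ⟨hz0, ((h.le_iff s hs z hz0).1 h2).antisymm (hl.1.2 ▸ h.mono hl.1.1 hz0 h1)⟩
  · rintro hz
    exact ⟨hl.2 hz, (h.le_iff s hs z hz.1).2 hz.2.le⟩

theorem completedGraph_eq {t : ℝ} (ht : t ∈ dom ζ) :
    completedGraph e t = (fun z => (z, Z m z)) '' Icc 0 (e t) := by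
  ext ⟨z, s⟩
  constructor
  · rintro ⟨hs, hz⟩
    obtain ⟨hz0, hzs⟩ := (h.mem_uIcc_iff (mem_dom_of_le hs.1 hs.2 ht)).1 hz
    exact ⟨z, ⟨hz0, (h.le_iff t ht z hz0).2 (hzs.trans_le hs.2)⟩, Prod.ext rfl hzs⟩
  · rintro ⟨w, hw, hws⟩
    obtain ⟨rfl, rfl⟩ := Prod.mk.inj hws
    have hwt := (h.le_iff t ht w hw.1).1 hw.2
    have hw0 := h.Z_nonneg hw.1
    exact ⟨⟨hw0, hwt⟩, (h.mem_uIcc_iff (mem_dom_of_le hw0 hwt ht)).2 ⟨hw.1, rfl⟩⟩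

end IsRightContInverse

/-- The graph of `m` over `[0, c]`, parametrised proportionally to its first coordinate. -/
noncomputable def graphParam (m : PathSpace) (c : ℝ) : C(unitInterval, ℝ × ℝ) :=
  ⟨fun r => (r * c, Z m (r * c)), by
    have := continuous_Z m
    fun_prop⟩

theorem continuous_graphParam : Continuous fun p : PathSpace × ℝ => graphParam p.1 p.2 := by
  refine ContinuousMap.continuous_of_continuous_uncurry _ ?_
  have h1 : Continuous fun p : (PathSpace × ℝ) × unitInterval => (p.2 : ℝ) * p.1.2 := by fun_prop
  have h2 : Continuous fun p : (PathSpace × ℝ) × unitInterval =>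
      p.1.1.1 ((p.2 : ℝ) * p.1.2).toNNReal :=
    (continuous_subtype_val.comp (continuous_fst.comp continuous_fst)).eval
      (continuous_real_toNNReal.comp h1)
  exact h1.prodMk h2

theorem IsRightContInverse.graphParam_mem {ζ : EReal} {m : PathSpace} {e : ℝ → ℝ}
    (h : IsRightContInverse ζ m e) {t : ℝ} (ht : t ∈ dom ζ) :
    graphParam m (e t) ∈ paramReps e t := by
  have hc := h.nonneg ht
  have hmem : ∀ r : unitInterval, 0 ≤ (r : ℝ) * e t ∧ (r : ℝ) * e t ≤ e t := fun r =>
    ⟨mul_nonneg r.2.1 hc, mul_le_of_le_one_left hc r.2.2⟩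
  refine ⟨?_, fun a b hab => ?_⟩
  · rw [h.completedGraph_eq ht]
    ext p
    constructor
    · rintro ⟨r, rfl⟩
      exact ⟨r * e t, hmem r, rfl⟩
    · rintro ⟨z, hz, rfl⟩
      rcases hc.eq_or_lt with h0 | h0
      · have hz0 : z = 0 := le_antisymm (by rw [h0]; exact hz.2) hz.1
        refine ⟨0, ?_⟩
        simp [graphParam, hz0]
      · refine ⟨⟨z / e t, div_nonneg hz.1 hc, div_le_one_of_le₀ hz.2 hc⟩, ?_⟩
        simp [graphParam, div_mul_cancel₀ z h0.ne']
  · have hab' : (a : ℝ) * e t ≤ b * e t := mul_le_mul_of_nonneg_right hab hc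
    change _ < _ ∨ _
    rcases (h.mono (hmem a).1 (hmem b).1 hab').lt_or_eq with hlt | heq
    · exact Or.inl hlt
    -- On a vertical segment the left limit is the least point, so the distance to it grows with the
    -- first coordinate.
    · refine Or.inr ⟨heq, ?_⟩
      have hs : Z m (a * e t) ∈ dom ζ :=
        mem_dom_of_le (h.Z_nonneg (hmem a).1) ((h.le_iff t ht _ (hmem a).1).1 (hmem a).2) ht
      have hl := (h.isLeast_leftValue hs).2 ⟨(hmem a).1, rfl⟩
      change |leftValue e (Z m (a * e t)) - a * e t| ≤ |leftValue e (Z m (b * e t)) - b * e t|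
      rw [← heq, abs_sub_comm, abs_sub_comm _ (b * e t), abs_of_nonneg (sub_nonneg.2 hl),
        abs_of_nonneg (sub_nonneg.2 (hl.trans hab'))]
      linarith

/-- The distance is at most that of the two canonical parametrisations, which depend continuously on
the inverse path and the end value. -/
theorem tendsto_m1Dist {ι : Type*} {l : Filter ι} {T : ι → EReal} {m : ι → PathSpace}
    {x : ι → ℝ → ℝ} {ζ : EReal} {m₀ : PathSpace} {y : ℝ → ℝ}
    (h : ∀ᶠ i in l, IsRightContInverse (T i) (m i) (x i)) (h₀ : IsRightContInverse ζ m₀ y)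
    (hm : Tendsto m l (𝓝 m₀)) {t : ℝ} (ht : ∀ᶠ i in l, t ∈ dom (T i)) (ht₀ : t ∈ dom ζ)
    (hx : Tendsto (fun i => x i t) l (𝓝 (y t))) :
    Tendsto (fun i => m1Dist t (x i) y) l (𝓝 0) := by
  have h1 : Tendsto (fun i => graphParam (m i) (x i t)) l (𝓝 (graphParam m₀ (y t))) :=
    (continuous_graphParam.tendsto (m₀, y t)).comp (hm.prodMk_nhds hx)
  refine tendsto_of_tendsto_of_tendsto_of_le_of_le' tendsto_const_nhds
    (tendsto_iff_edist_tendsto_0.1 h1) (Eventually.of_forall fun _ => zero_le) ?_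
  filter_upwards [h, ht] with i hi hti
  exact iInf₂_le_of_le _ (hi.graphParam_mem hti) (iInf₂_le_of_le _ (h₀.graphParam_mem ht₀) le_rfl)

theorem IsTimeChange.isRightContInverse {T : EReal} {φ : ℝ → ℝ} (h : IsTimeChange T φ)
    {m : PathSpace} (hm : ∀ x, 0 ≤ x → Z m x = exit T φ x) : IsRightContInverse T m φ where
  mono x hx z hz hxz := by
    rw [hm x hx, hm z hz]
    exact h.strictMonoOn_exit.monotoneOn hx hz hxz
  le_iff t ht z hz := by
    rw [hm z hz, ← not_lt, ← not_lt, h.lt_exit_iff ht hz]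

/-! ### Running suprema -/

/-- The running supremum of a path. -/
noncomputable def runSup (ψ : ℝ → ℝ) (x : ℝ) : ℝ := sSup ((fun r => ψ (x * r)) '' Icc 0 1)

section RunSup

variable {ψ : ℝ → ℝ} (hψ : Continuous ψ)
include hψ

/-- After rescaling, the supremum runs over the fixed compact set `[0, 1]`. -/
theorem continuous_runSup : Continuous (runSup ψ) :=
  isCompact_Icc.continuous_sSup (f := fun x r => ψ (x * r)) (by
    change Continuous fun p : ℝ × ℝ => ψ (p.1 * p.2)
    fun_prop)

theorem le_runSup {u x : ℝ} (hu : 0 ≤ u) (hux : u ≤ x) : ψ u ≤ runSup ψ x := by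
  refine le_csSup (isCompact_Icc.image (by fun_prop)).bddAbove ?_
  rcases (hu.trans hux).eq_or_lt with h | h
  · exact ⟨0, by simp, by simp [← h, le_antisymm (hux.trans h.ge) hu]⟩
  · exact ⟨u / x, ⟨div_nonneg hu h.le, div_le_one_of_le₀ hux h.le⟩,
      by simp [mul_div_cancel₀ u h.ne']⟩

theorem exists_eq_runSup {x : ℝ} (hx : 0 ≤ x) : ∃ u ∈ Icc 0 x, ψ u = runSup ψ x := by
  obtain ⟨r, hr, he⟩ := (isCompact_Icc (a := (0 : ℝ)) (b := 1)).exists_sSup_image_eq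
    ⟨0, by simp⟩ (f := fun r => ψ (x * r)) (by fun_prop)
  exact ⟨x * r, ⟨mul_nonneg hx hr.1, mul_le_of_le_one_right hx hr.2⟩, he.symm⟩

theorem runSup_mono : MonotoneOn (runSup ψ) (Ici 0) := fun x hx z _ hxz => by
  obtain ⟨u, hu, he⟩ := exists_eq_runSup hψ (x := x) hx
  rw [← he]
  exact le_runSup hψ hu.1 (hu.2.trans hxz)

theorem runSup_le {x a : ℝ} (hx : 0 ≤ x) (h : ∀ u, 0 ≤ u → u ≤ x → ψ u ≤ a) :
    runSup ψ x ≤ a := by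
  obtain ⟨u, hu, he⟩ := exists_eq_runSup hψ hx
  rw [← he]
  exact h u hu.1 hu.2

/-- A maximum attained only at the excluded end point `x` is approached from the left by continuity.
-/
theorem S_eq_runSup {x : ℝ} (hx : 0 ≤ x) : S ψ x = runSup ψ x := by
  refine le_antisymm (max_le (EReal.coe_le_coe_iff.2 (le_runSup hψ le_rfl hx))
    (iSup₂_le fun u hu => EReal.coe_le_coe_iff.2 (le_runSup hψ hu.1
      (EReal.coe_lt_coe_iff.1 hu.2).le))) ?_
  have key : ∀ u, 0 ≤ u → u < x → (ψ u : EReal) ≤ S ψ x := fun u hu hux =>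
    le_max_of_le_right (le_iSup₂_of_le (f := fun u (_ : u ∈ dom x) => (ψ u : EReal)) u
      ⟨hu, EReal.coe_lt_coe_iff.2 hux⟩ le_rfl)
  obtain ⟨u, hu, he⟩ := exists_eq_runSup hψ hx
  rw [← he]
  rcases hu.2.lt_or_eq with h | rfl
  · exact key u hu.1 h
  rcases hx.eq_or_lt with h | h
  · rw [← h]
    exact le_max_left _ _
  refine le_of_tendsto (((continuous_coe_real_ereal.comp hψ).tendsto u).mono_left
    (nhdsWithin_le_nhds (s := Iio u))) ?_
  filter_upwards [self_mem_nhdsWithin, mem_nhdsWithin_of_mem_nhds (lt_mem_nhds h)] with v hv hv'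
  exact key v (le_of_lt hv') hv

omit hψ in
theorem coe_lt_S_top_iff {t : ℝ} : (t : EReal) < S ψ ⊤ ↔ ∃ u, 0 ≤ u ∧ t < ψ u := by
  simp only [S, lt_max_iff, lt_iSup_iff, EReal.coe_lt_coe_iff, dom, mem_ofPred_eq,
    EReal.coe_lt_top, and_true, exists_prop]
  exact ⟨fun h => h.elim (fun h => ⟨0, le_rfl, h⟩) id, Or.inr⟩

/-- Exceeding `t` is an open condition, so a maximiser above `t`, even at `z` itself, has earlier
points above `t`. It is not `0`, since `ψ 0 = 0 ≤ t`. -/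
theorem E_lt_iff (h0 : ψ 0 = 0) {t z : ℝ} (ht : 0 ≤ t) (hz : 0 ≤ z) :
    E ⊤ ψ t < z ↔ t < runSup ψ z := by
  simp only [E, sInf_lt_iff, exists_mem_image, EReal.coe_lt_coe_iff, dom, mem_ofPred_eq,
    EReal.coe_lt_top, and_true]
  constructor
  · rintro ⟨u, ⟨hu, -, htu⟩, huz⟩
    exact htu.trans_le (le_runSup hψ hu huz.le)
  · intro h
    obtain ⟨u, hu, he⟩ := exists_eq_runSup hψ hz
    rw [← he] at h
    have hu0 : 0 < u := hu.1.lt_of_ne fun hu0 => by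
      rw [← hu0, h0] at h
      linarith
    obtain ⟨v, ⟨hv, hv0⟩, hvu⟩ := ((((hψ.tendsto u).eventually (lt_mem_nhds h)).and
      (lt_mem_nhds hu0)).filter_mono (nhdsWithin_le_nhds (s := Iio u)) |>.and
      self_mem_nhdsWithin).exists
    exact ⟨v, ⟨le_of_lt hv0, hv0, hv⟩, lt_of_lt_of_le hvu hu.2⟩

omit hψ in
theorem E_nonneg (T : EReal) (t : ℝ) : 0 ≤ E T ψ t := by
  refine le_sInf ?_
  rintro _ ⟨u, hu, rfl⟩
  exact EReal.coe_nonneg.2 hu.1.1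

theorem E_ne_top_iff (h0 : ψ 0 = 0) {t : ℝ} (ht : 0 ≤ t) :
    E ⊤ ψ t ≠ ⊤ ↔ (t : EReal) < S ψ ⊤ := by
  rw [coe_lt_S_top_iff, ← lt_top_iff_ne_top]
  constructor
  · intro h
    obtain ⟨z, hz, -⟩ := EReal.lt_iff_exists_real_btwn.1 h
    have hz0 : (0 : ℝ) ≤ z := by exact_mod_cast (E_nonneg ⊤ t).trans hz.le
    obtain ⟨u, hu, he⟩ := exists_eq_runSup hψ hz0
    exact ⟨u, hu.1, he ▸ (E_lt_iff hψ h0 ht hz0).1 hz⟩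
  · rintro ⟨u, hu, htu⟩
    exact ((E_lt_iff hψ h0 ht hu).2 (htu.trans_le (le_runSup hψ hu le_rfl))).trans
      (EReal.coe_lt_top u)

theorem coe_toReal_E (h0 : ψ 0 = 0) {t : ℝ} (ht : t ∈ dom (S ψ ⊤)) :
    ((E ⊤ ψ t).toReal : EReal) = E ⊤ ψ t :=
  EReal.coe_toReal ((E_ne_top_iff hψ h0 ht.1).2 ht.2)
    (fun h => by simpa [h] using E_nonneg (ψ := ψ) ⊤ t)

theorem isRightContInverse_E (h0 : ψ 0 = 0) {m : PathSpace}
    (hm : ∀ x, 0 ≤ x → Z m x = runSup ψ x) :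
    IsRightContInverse (S ψ ⊤) m (fun t => (E ⊤ ψ t).toReal) where
  mono x hx z hz hxz := by
    rw [hm x hx, hm z hz]
    exact runSup_mono hψ hx hz hxz
  le_iff t ht z hz := by
    rw [hm z hz, ← EReal.coe_le_coe_iff, coe_toReal_E hψ h0 ht, ← not_lt, E_lt_iff hψ h0 ht.1 hz,
      not_lt]

end RunSup

/-! ### Convergence of the inverses -/

/-- The value `∞` after the life time is what keeps this equivalence valid there, since every exit
time lies below `T`. -/
theorem IsTimeChange.exit_le_iff_le_extValue {T : EReal} {φ : ℝ → ℝ} (h : IsTimeChange T φ)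
    {t z : ℝ} (ht : 0 ≤ t) (hz : 0 ≤ z) : exit T φ z ≤ t ↔ (z : EReal) ≤ extValue T φ t := by
  by_cases htT : (t : EReal) < T
  · rw [extValue, if_pos htT, EReal.coe_le_coe_iff, ← not_lt, h.lt_exit_iff ⟨ht, htT⟩ hz, not_lt]
  · rw [extValue, if_neg htT]
    simp only [le_top, iff_true]
    exact_mod_cast (h.exit_mem hz).2.le.trans (not_lt.1 htT)

theorem tendsto_extValue {ι : Type*} {l : Filter ι} {T : ι → EReal} {φ : ι → ℝ → ℝ}
    (h : ∀ᶠ i in l, IsTimeChange (T i) (φ i)) {ψ : ℝ → ℝ} (hψ : Continuous ψ) (h0 : ψ 0 = 0)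
    (hlim : ∀ z, 0 ≤ z → Tendsto (fun i => exit (T i) (φ i) z) l (𝓝 (runSup ψ z)))
    {t : ℝ} (ht : 0 < t) (hc : ContinuousAt (fun s : ℝ => E ⊤ ψ s) t) :
    Tendsto (fun i => extValue (T i) (φ i) t) l (𝓝 (E ⊤ ψ t)) := by
  refine tendsto_order.2 ⟨fun a ha => ?_, fun b hb => ?_⟩
  · rcases lt_or_ge a 0 with ha0 | ha0
    · filter_upwards [h] with i hi
      have := (hi.exit_le_iff_le_extValue ht.le le_rfl).1 (by rw [hi.exit_zero]; exact ht.le)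
      exact ha0.trans_le (by simpa using this)
    -- Stepping back to `s < t` leaves strict room between `runSup ψ z ≤ s` and `t`. Only this lower
    -- bound uses continuity at `t`.
    obtain ⟨s, ⟨hs, hs0⟩, hst⟩ := (((hc.eventually (lt_mem_nhds ha)).and
      (lt_mem_nhds ht)).filter_mono (nhdsWithin_le_nhds (s := Iio t)) |>.and
      self_mem_nhdsWithin).exists
    obtain ⟨z, haz, hz⟩ := EReal.lt_iff_exists_real_btwn.1 hs
    have hz0 : (0 : ℝ) ≤ z := by exact_mod_cast ha0.trans haz.le
    have hzs : runSup ψ z ≤ s :=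
      not_lt.1 fun hlt => lt_asymm hz ((E_lt_iff hψ h0 (le_of_lt hs0) hz0).2 hlt)
    filter_upwards [h, (hlim z hz0).eventually (gt_mem_nhds (hzs.trans_lt hst))] with i hi hi'
    exact haz.trans_le ((hi.exit_le_iff_le_extValue ht.le hz0).1 (le_of_lt hi'))
  · obtain ⟨z, hz, hzb⟩ := EReal.lt_iff_exists_real_btwn.1 hb
    have hz0 : (0 : ℝ) ≤ z := by exact_mod_cast (E_nonneg ⊤ t).trans hz.le
    filter_upwards [h, (hlim z hz0).eventually (lt_mem_nhds ((E_lt_iff hψ h0 ht.le hz0).1 hz))]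
      with i hi hi'
    refine lt_trans (not_le.1 fun hle => ?_) hzb
    exact absurd ((hi.exit_le_iff_le_extValue ht.le hz0).2 hle) (not_le.2 hi')

theorem tendstoM1_of_tendsto_exit {ι : Type*} {l : Filter ι} {T : ι → EReal} {φ : ι → ℝ → ℝ}
    {m : ι → PathSpace} {m₀ : PathSpace}
    (h : ∀ᶠ i in l, IsTimeChange (T i) (φ i)) {ψ : ℝ → ℝ} (hψ : Continuous ψ) (h0 : ψ 0 = 0)
    (hm : ∀ᶠ i in l, ∀ x, 0 ≤ x → Z (m i) x = exit (T i) (φ i) x)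
    (hm₀ : ∀ x, 0 ≤ x → Z m₀ x = runSup ψ x) (hlim : Tendsto m l (𝓝 m₀))
    (hlim' : ∀ z, 0 ≤ z → Tendsto (fun i => exit (T i) (φ i) z) l (𝓝 (runSup ψ z))) :
    TendstoM1 l T φ (S ψ ⊤) (fun t => (E ⊤ ψ t).toReal) := by
  intro t ht htζ hc
  have htd : t ∈ dom (S ψ ⊤) := ⟨ht.le, htζ⟩
  have hev : ∀ᶠ i in l, (t : EReal) < T i := by
    obtain ⟨u, hu, htu⟩ := coe_lt_S_top_iff.1 htζ
    filter_upwards [h, (hlim' u hu).eventually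
      (lt_mem_nhds (htu.trans_le (le_runSup hψ hu le_rfl)))] with i hi hi'
    exact (EReal.coe_lt_coe_iff.2 hi').trans (hi.exit_mem hu).2
  have hcE : ContinuousAt (fun s : ℝ => E ⊤ ψ s) t := by
    refine (continuous_coe_real_ereal.continuousAt.comp hc).congr ?_
    filter_upwards [dom_mem_nhds htd ht] with s hs using coe_toReal_E hψ h0 hs
  have hval : Tendsto (fun i => φ i t) l (𝓝 (E ⊤ ψ t).toReal) := by
    rw [← EReal.tendsto_coe, coe_toReal_E hψ h0 htd]
    refine (tendsto_extValue h hψ h0 hlim' ht hcE).congr' ?_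
    filter_upwards [hev] with i hi
    rw [extValue, if_pos hi]
  refine ⟨hev, tendsto_m1Dist ?_ (isRightContInverse_E hψ h0 hm₀) hlim
    (hev.mono fun i hi => ⟨ht.le, hi⟩) htd hval⟩
  filter_upwards [h, hm] with i hi hi' using hi.isRightContInverse hi'

/-! ### The driving path of a time change -/

section Driving

variable {ε : ℝ} (hε : 0 < ε) {T : EReal} {φ : ℝ → ℝ}

theorem IsIVPSolution.derivWithin_eq {ω : PathSpace} (h : IsIVPSolution ε ω T φ) {t : ℝ}
    (ht : t ∈ dom T) : derivWithin φ (dom T) t = drive ε ω t (φ t) :=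
  (h.deriv t ht).derivWithin (uniqueDiffWithinAt_dom ht)

include hε

theorem IsTimeChange.isIVPSolution_iff (h : IsTimeChange T φ) (hd : DifferentiableOn ℝ φ (dom T))
    (ω : PathSpace) : IsIVPSolution ε ω T φ ↔ ∀ x, 0 ≤ x →
      Z ω x = x - exit T φ x + ε * (derivWithin φ (dom T) (exit T φ x) - 1) := by
  constructor
  · intro hI x hx
    rw [hI.derivWithin_eq (h.exit_mem hx), h.apply_exit hx]
    unfold drive
    field_simp
    ring
  · intro hZ
    refine ⟨h.pos, h.apply_zero, fun t ht => h.bijOn.mapsTo ht, fun t ht => ?_⟩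
    have h1 := hZ (φ t) (h.bijOn.mapsTo ht)
    rw [h.exit_apply ht] at h1
    have h2 : drive ε ω t (φ t) = derivWithin φ (dom T) t := by
      unfold drive
      rw [h1]
      field_simp
      ring
    rw [h2]
    exact (hd t ht).hasDerivWithinAt

theorem IsTimeChange.exists_isIVPSolution_iff (h : IsTimeChange T φ)
    (hd : DifferentiableOn ℝ φ (dom T)) : (∃ ω : PathSpace, IsIVPSolution ε ω T φ) ↔
      ContinuousOn (derivWithin φ (dom T)) (dom T) ∧ derivWithin φ (dom T) 0 = 1 := by
  constructor
  · rintro ⟨ω, hI⟩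
    refine ⟨hI.continuousOn_drive.congr fun t ht => hI.derivWithin_eq ht, ?_⟩
    rw [hI.derivWithin_eq (zero_mem_dom h.pos), h.apply_zero]
    simp [drive, Z_zero]
  · rintro ⟨hc, h1⟩
    have hexit := h.continuousOn_exit
    have hcomp : ContinuousOn (fun x => derivWithin φ (dom T) (exit T φ x)) (Ici 0) :=
      hc.comp hexit fun x hx => h.exit_mem hx
    refine ⟨toPath (fun x => x - exit T φ x + ε * (derivWithin φ (dom T) (exit T φ x) - 1))
      (by fun_prop) (by simp [h.exit_zero, h1]), ?_⟩
    rw [h.isIVPSolution_iff hε hd]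
    exact fun x hx => Z_toPath _ _ hx

end Driving

/-! ### The exit-time path and its limit as `ε → 0` -/

theorem continuous_eSubZ (ω : PathSpace) : Continuous (eSubZ ω) :=
  continuous_id.sub (continuous_Z ω)

theorem eSubZ_zero (ω : PathSpace) : eSubZ ω 0 = 0 := by simp [eSubZ, Z_zero]

section ExitPath

variable {ε : ℝ} (hε : 0 < ε) (ω : PathSpace)
include hε

theorem runSup_sub_le_exit {x : ℝ} (hx : 0 ≤ x) :
    runSup (eSubZ ω) x - ε ≤ exit (lifeTime ε ω) (timeAvg (vol ε ω)) x := by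
  have h := isTimeChange_timeAvg_vol hε ω
  refine sub_le_iff_le_add.2 (runSup_le (continuous_eSubZ ω) hx fun u hu hux => ?_)
  have h1 := (isIVPSolution_timeAvg_vol hε ω).sub_le_exit hε h hu
  have h2 := h.strictMonoOn_exit.monotoneOn hu hx hux
  linarith

theorem exit_le_runSup_add {x : ℝ} (hx : 0 ≤ x) :
    exit (lifeTime ε ω) (timeAvg (vol ε ω)) x ≤ runSup (eSubZ ω) x + 2 * √(x * ε) := by
  have hψ := continuous_eSubZ ω
  refine (isIVPSolution_timeAvg_vol hε ω).exit_le hε (isTimeChange_timeAvg_vol hε ω) hx ?_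
    fun u hu hux => le_runSup hψ hu hux.le
  simpa [eSubZ_zero] using le_runSup hψ le_rfl hx

/-- Strict, because every level is exited strictly before the life time. -/
theorem eSubZ_lt_lifeTime_add {u : ℝ} (hu : 0 ≤ u) :
    (eSubZ ω u : EReal) < lifeTime ε ω + (ε : EReal) := by
  have h := isTimeChange_timeAvg_vol hε ω
  have h1 := (isIVPSolution_timeAvg_vol hε ω).sub_le_exit hε h hu
  have h2 : (eSubZ ω u : EReal) ≤ (exit (lifeTime ε ω) (timeAvg (vol ε ω)) u : EReal) + ε := by
    rw [← EReal.coe_add, EReal.coe_le_coe_iff]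
    linarith
  exact h2.trans_lt (EReal.add_lt_add_of_lt_of_le (h.exit_mem hu).2 le_rfl
    (EReal.coe_ne_bot _) (EReal.coe_ne_top _))

theorem S_top_le_lifeTime_add : S (eSubZ ω) ⊤ ≤ lifeTime ε ω + (ε : EReal) :=
  max_le (eSubZ_lt_lifeTime_add hε ω le_rfl).le
    (iSup₂_le fun _ hu => (eSubZ_lt_lifeTime_add hε ω hu.1).le)

end ExitPath

/-- The running supremum of `e - Z(ω)`, as an element of the path space. -/
noncomputable def limitPath (ω : PathSpace) : PathSpace :=
  toPath (runSup (eSubZ ω)) (continuous_runSup (continuous_eSubZ ω)).continuousOn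
    (by simp [runSup, eSubZ_zero])

open Classical in
/-- The exit times of the time-average of the volatility, as an element of the path space. -/
noncomputable def exitPath (ω : PathSpace) (ε : ℝ) : PathSpace :=
  if hε : 0 < ε then
    toPath (exit (lifeTime ε ω) (timeAvg (vol ε ω)))
      (isTimeChange_timeAvg_vol hε ω).continuousOn_exit (isTimeChange_timeAvg_vol hε ω).exit_zero
  else limitPath ω

theorem Z_limitPath (ω : PathSpace) {x : ℝ} (hx : 0 ≤ x) :
    Z (limitPath ω) x = runSup (eSubZ ω) x := Z_toPath _ _ hx

theorem Z_exitPath (ω : PathSpace) {ε : ℝ} (hε : 0 < ε) {x : ℝ} (hx : 0 ≤ x) :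
    Z (exitPath ω ε) x = exit (lifeTime ε ω) (timeAvg (vol ε ω)) x := by
  rw [exitPath, dif_pos hε]
  exact Z_toPath _ _ hx

theorem tendsto_exitPath (ω : PathSpace) : Tendsto (exitPath ω) (𝓝[>] 0) (𝓝 (limitPath ω)) := by
  refine tendsto_path_iff.2 fun x hx δ hδ => ?_
  have hlim : Tendsto (fun ε : ℝ => ε + 2 * √(x * ε)) (𝓝[>] 0) (𝓝 0) := by
    have : Continuous fun ε : ℝ => ε + 2 * √(x * ε) := by fun_prop
    simpa using (this.tendsto 0).mono_left (nhdsWithin_le_nhds (s := Ioi (0 : ℝ)))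
  filter_upwards [self_mem_nhdsWithin, hlim.eventually (gt_mem_nhds hδ)] with ε hε hlt u hu
  have hε' : 0 < ε := hε
  rw [Z_exitPath ω hε' hu.1, Z_limitPath ω hu.1, abs_lt]
  have h1 := runSup_sub_le_exit hε' ω hu.1
  have h2 := exit_le_runSup_add hε' ω hu.1
  have h3 : √(u * ε) ≤ √(x * ε) := Real.sqrt_le_sqrt (by gcongr; exact hu.2)
  have h4 := Real.sqrt_nonneg (x * ε)
  constructor <;> linarith

theorem tendsto_exit (ω : PathSpace) {z : ℝ} (hz : 0 ≤ z) :
    Tendsto (fun ε => exit (lifeTime ε ω) (timeAvg (vol ε ω)) z) (𝓝[>] 0)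
      (𝓝 (runSup (eSubZ ω) z)) := by
  have hev : Continuous fun f : PathSpace => Z f z :=
    (continuous_eval_const z.toNNReal).comp continuous_subtype_val
  have h := (hev.tendsto _).comp (tendsto_exitPath ω)
  rw [Z_limitPath ω hz] at h
  refine h.congr' ?_
  filter_upwards [self_mem_nhdsWithin] with ε hε using Z_exitPath ω hε hz

end CIR

theorem mainTheorem6 (P : Measure PathSpace) [IsProbabilityMeasure P] :
    -- Existence: life times `T ε ω` and processes `X ε` solving the equation along every path.
    (∃ (T : ℝ → PathSpace → EReal) (X : ℝ → PathSpace → ℝ → ℝ),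
      (∀ ε : ℝ, 0 < ε → IsTCEProcess ε (T ε) (X ε)) ∧
      -- Uniqueness of the process under `P`.
      (∀ ε : ℝ, 0 < ε → ∀ (T' : PathSpace → EReal) (X' : PathSpace → ℝ → ℝ),
        (∀ᵐ ω ∂P, IsTCEPath ε ω (T' ω) (X' ω)) →
        ∀ᵐ ω ∂P, T' ω ≤ T ε ω ∧ EqOn (X' ω) (X ε ω) (dom (T' ω))) ∧
      ∀ ω : PathSpace,
        (∀ ε : ℝ, 0 < ε →
          -- The time-average solves the initial-value problem and is a bijection onto `[0, ∞)`.
          IsIVPSolution ε ω (T ε ω) (timeAvg (X ε ω)) ∧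
          BijOn (timeAvg (X ε ω)) (dom (T ε ω)) (Ici 0) ∧
          -- The volatility is nonnegative, and vanishes on no time interval.
          (∀ t ∈ dom (T ε ω), 0 ≤ X ε ω t) ∧
          interior {t | t ∈ dom (T ε ω) ∧ X ε ω t = 0} = ∅ ∧
          -- The lower bound on the life time.
          S (eSubZ ω) ⊤ ≤ T ε ω + (ε : EReal) ∧
          (∀ u : ℝ, 0 ≤ u → (eSubZ ω u : EReal) < T ε ω + (ε : EReal)) ∧
          -- Pathwise uniqueness, for the time-change equation and the initial-value problem.
          (∀ (T' : EReal) (X' : ℝ → ℝ), IsTCEPath ε ω T' X' →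
            T' ≤ T ε ω ∧ EqOn X' (X ε ω) (dom T')) ∧
          (∀ (T' : EReal) (ψ : ℝ → ℝ), IsIVPSolution ε ω T' ψ →
            T' ≤ T ε ω ∧ EqOn ψ (timeAvg (X ε ω)) (dom T'))) ∧
        -- The exit times `Xhat ε = E(X̄ ε)` and the limit `X0hat = S(e - Z)`, as elements of `C`.
        (∃ (Xhat : ℝ → PathSpace) (X0hat : PathSpace),
          (∀ x : ℝ, 0 ≤ x → (Z X0hat x : EReal) = S (eSubZ ω) x) ∧
          (∀ ε : ℝ, 0 < ε → ∀ x : ℝ, 0 ≤ x →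
            E (T ε ω) (timeAvg (X ε ω)) x = (Z (Xhat ε) x : EReal) ∧
            Z X0hat x - ε ≤ Z (Xhat ε) x ∧
            Z (Xhat ε) x ≤ Z X0hat x + 2 * √(x * ε) ∧
            -- `Xhat ε` is the inverse of `X̄ ε`, with derivative `1 / X` where `X ≠ 0`.
            Z (Xhat ε) x ∈ dom (T ε ω) ∧
            timeAvg (X ε ω) (Z (Xhat ε) x) = x ∧
            (X ε ω (Z (Xhat ε) x) ≠ 0 →
              HasDerivWithinAt (Z (Xhat ε)) (X ε ω (Z (Xhat ε) x))⁻¹ (Ici 0) x) ∧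
            (X ε ω (Z (Xhat ε) x) = 0 →
              ¬ DifferentiableWithinAt ℝ (Z (Xhat ε)) (Ici 0) x)) ∧
          Tendsto Xhat (𝓝[>] 0) (𝓝 X0hat)) ∧
        -- The limit `E(e - Z)` is finite and càdlàg exactly before its life time `S(e - Z)(∞)`.
        (∀ t : ℝ, 0 ≤ t → (E ⊤ (eSubZ ω) t ≠ ⊤ ↔ (t : EReal) < S (eSubZ ω) ⊤)) ∧
        IsCadlagOn (S (eSubZ ω) ⊤) (fun t => (E ⊤ (eSubZ ω) t).toReal) ∧
        (∀ ε : ℝ, 0 < ε → IsCadlagOn (T ε ω) (timeAvg (X ε ω))) ∧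
        -- `M₁` convergence of the time-averages on the life time of the limit.
        TendstoM1 (𝓝[>] (0 : ℝ)) (fun ε => T ε ω) (fun ε => timeAvg (X ε ω))
          (S (eSubZ ω) ⊤) (fun t => (E ⊤ (eSubZ ω) t).toReal) ∧
        -- Pointwise convergence in `[0, ∞]` at continuity points, also beyond that life time.
        (∀ t : ℝ, 0 < t → ContinuousAt (fun s : ℝ => E ⊤ (eSubZ ω) s) t →
          Tendsto (fun ε : ℝ => extValue (T ε ω) (timeAvg (X ε ω)) t) (𝓝[>] 0)
            (𝓝 (E ⊤ (eSubZ ω) t)))) ∧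
    -- The space of solutions.
    (∀ ε : ℝ, 0 < ε → ∀ (T : EReal) (φ : ℝ → ℝ),
      DifferentiableOn ℝ φ (dom T) → BijOn φ (dom T) (Ici 0) →
      -- The driving path of `φ` is `x - φhat(x) + ε (1 / φhat'(x) - 1)`, where `φhat = E(φ)` and
      -- `1 / φhat'(x) = φ'(φhat(x))`.
      (∀ ω : PathSpace, IsIVPSolution ε ω T φ ↔ ∀ x : ℝ, 0 ≤ x →
        Z ω x = x - (E T φ x).toReal +
          ε * (derivWithin φ (dom T) (E T φ x).toReal - 1)) ∧
      (∀ x : ℝ, 0 ≤ x → derivWithin φ (dom T) (E T φ x).toReal ≠ 0 →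
        HasDerivWithinAt (fun y : ℝ => (E T φ y).toReal)
          (derivWithin φ (dom T) (E T φ x).toReal)⁻¹ (Ici 0) x) ∧
      -- `φ` has a driving path exactly if `φ'` is continuous with `φ'(0) = 1`.
      ((∃ ω : PathSpace, IsIVPSolution ε ω T φ) ↔
        ContinuousOn (derivWithin φ (dom T)) (dom T) ∧ derivWithin φ (dom T) 0 = 1)) := by
  refine ⟨⟨lifeTime, vol, fun ε hε => isTCEProcess_vol hε, ?_, fun ω => ?_⟩, ?_⟩
  · intro ε hε T' X' h
    filter_upwards [h] with ω hω using ⟨hω.le_lifeTime hε, hω.eqOn_vol hε⟩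
  · have hψ := continuous_eSubZ ω
    have hψ0 := eSubZ_zero ω
    have htc : ∀ᶠ ε : ℝ in 𝓝[>] 0, IsTimeChange (lifeTime ε ω) (timeAvg (vol ε ω)) := by
      filter_upwards [self_mem_nhdsWithin] with ε hε using isTimeChange_timeAvg_vol hε ω
    have hinv := isRightContInverse_E hψ hψ0 fun x hx => Z_limitPath ω hx
    refine ⟨fun ε hε => ?_, ⟨exitPath ω, limitPath ω, fun x hx => ?_, fun ε hε x hx => ?_,
      tendsto_exitPath ω⟩, fun t ht => E_ne_top_iff hψ hψ0 ht, hinv.isCadlagOn, fun ε hε => ?_,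
      tendstoM1_of_tendsto_exit htc hψ hψ0 ?_ (fun x hx => Z_limitPath ω hx) (tendsto_exitPath ω)
        fun z hz => tendsto_exit ω hz,
      fun t ht hc => tendsto_extValue htc hψ hψ0 (fun z hz => tendsto_exit ω hz) ht hc⟩
    · have hivp := isIVPSolution_timeAvg_vol hε ω
      refine ⟨hivp, (isTimeChange_timeAvg_vol hε ω).bijOn, fun t ht => ?_,
        interior_setOf_vol_eq_zero hε ω, S_top_le_lifeTime_add hε ω,
        fun u hu => eSubZ_lt_lifeTime_add hε ω hu,
        fun T' X' h => ⟨h.le_lifeTime hε, h.eqOn_vol hε⟩,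
        fun T' ψ h => ⟨h.le_lifeTime, h.eqOn_timeAvg_vol hε⟩⟩
      rw [vol_eq_drive hε ω ht]
      exact hivp.drive_nonneg hε ht
    · rw [Z_limitPath ω hx, S_eq_runSup hψ hx]
    · have h := isTimeChange_timeAvg_vol hε ω
      have hmem := h.exit_mem hx
      have hder := (isIVPSolution_timeAvg_vol hε ω).deriv _ hmem
      rw [← vol_eq_drive hε ω hmem] at hder
      have heq : EqOn (Z (exitPath ω ε)) (exit (lifeTime ε ω) (timeAvg (vol ε ω))) (Ici 0) :=
        fun z hz => Z_exitPath ω hε hz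
      rw [Z_exitPath ω hε hx, Z_limitPath ω hx]
      refine ⟨(h.coe_exit hx).symm, runSup_sub_le_exit hε ω hx, exit_le_runSup_add hε ω hx, hmem,
        h.apply_exit hx, fun h0 => (h.hasDerivWithinAt_exit hx hder h0).congr heq (heq hx),
        fun h0 hdiff => ?_⟩
      rw [h0] at hder
      exact h.not_differentiableWithinAt_exit hx hder
        (hdiff.congr (fun z hz => (heq hz).symm) (heq hx).symm)
    · exact ((isTimeChange_timeAvg_vol hε ω).isRightContInverse
        fun x hx => Z_exitPath ω hε hx).isCadlagOn
    · filter_upwards [self_mem_nhdsWithin] with ε hε x hx using Z_exitPath ω hε hx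
  · intro ε hε T φ hd hb
    -- A differentiable bijection onto `[0, ∞)` is automatically increasing, so the theory of time
    -- changes applies.
    have h := isTimeChange_of_continuousOn hd.continuousOn hb
    exact ⟨h.isIVPSolution_iff hε hd, fun x hx hne => h.hasDerivWithinAt_exit hx
      (hd _ (h.exit_mem hx)).hasDerivWithinAt hne, h.exists_isIVPSolution_iff hε hd⟩
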